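/- Let $1\le N\le 3$, let $\Omega\subset\mathbb R^N$ be a bounded domain (a nonempty connected open set), let $d\ge 2$, and let $0=a_0<a_1<\dots<a_m=d$ be integers. For $h=1,\dots,m$ put $I_h=\{i\in\{1,\dots,d\}: a_{h-1}<i\le a_h\}$, and let $$\mathcal K_1=\{(i,j): i\ne j,\ (i,j)\in I_h^2 \text{ for some } h\},\qquad \mathcal K_2=\{(i,j): (i,j)\in I_h\times I_k \text{ for some } h\neq k\}.$$ Let $V_i,\beta_{ij}\in L^\infty(\Omega)$ ($i,j=1,\dots,d$) be real-valued functions such that - $\beta_{ij}=\beta_{ji}$ a.e. in $\Omega$ for all $i\ne j$; - for every $i$ there is $\lambda_i>-\lambda_1(\Omega)$ with $V_i\ge\lambda_i$ a.e. in $\Omega$, where $\lambda_1(\Omega)$ is the first eigenvalue of the Laplacian on $\Omega$ with homogeneous Dirichlet boundary conditions; - for every $i$ there is $\mu_i>0$ with $\beta_{ii}\ge\mu_i$ a.e. in $\Omega$; - $\beta_{ij}\ge 0$ a.e. in $\Omega$ for every $(i,j)\in\mathcal K_1$; - $\beta_{ij}\le 0$ a.e. in $\Omega$ for every $(i,j)\in\mathcal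 K_2$. For $\mathbf u=(u_1,\dots,u_d)\in\mathbb H:=(H_0^1(\Omega))^d$ define $$J(\mathbf u)=\frac12\int_\Omega\sum_{i=1}^d\left(|\nabla u_i|^2+V_iu_i^2\right)-\frac14\int_\Omega\sum_{i,j=1}^d\beta_{ij}u_i^2u_j^2,$$ $$\|\mathbf u_h\|_h^2=\sum_{i\in I_h}\int_\Omega\left(|\nabla u_i|^2+V_iu_i^2\right),\qquad \mathbf M(\mathbf u)=\Big(\sum_{(i,j)\in I_h\times I_k}\int_\Omega\beta_{ij}u_i^2u_j^2\Big)_{h,k=1,\dots,m},$$ and, writing $\partial_iJ$ for the partial derivative of $J$ with respect to $u_i$, $$\mathcal N=\Big\{\mathbf u\in\mathbb H:\ \|\mathbf u_h\|_h^2\ne0\ \text{ and }\ \sum_{i\in I_h}\partial_iJ(\mathbf u)u_i=0\ \text{ for every } h=1,\dots,m\Big\},$$ $$\mathcal E=\{\mathbf u\in\mathbb H:\ \mathbf M(\mathbf u)\text{ is strictly diagonally dominant}\},$$ where an $m\times m$ matrix $A=(a_{hk})$ is strictly diagonally dominant if $|a_{hh}|>\sum_{k\ne h}|a_{hk}|$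 for every $h$. Then the infimum of $J$ on $\mathcal N$ is attained, every minimizer of $J$ on $\mathcal N$ belongs to $\mathcal E$, and in particular $$\inf_{\mathcal N}J=\inf_{\mathcal N\cap\mathcal E}J.$$ -/

import Mathlib

open MeasureTheory
open scoped ContDiff

noncomputable section

namespace NehariSystem

/-- The ambient space `ℝ^N` with its Euclidean norm. -/
abbrev RN (N : ℕ) : Type := EuclideanSpace ℝ (Fin N)

/-- Lebesgue measure on `Ω`. -/
abbrev vol {N : ℕ} (Ω : Set (RN N)) : Measure (RN N) := volume.restrict Ω

/-- `C_c^∞(Ω)`: smooth functions with compact support contained in `Ω`. -/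
def IsTestFun {N : ℕ} (Ω : Set (RN N)) (φ : RN N → ℝ) : Prop :=
  ContDiff ℝ ∞ φ ∧ HasCompactSupport φ ∧ tsupport φ ⊆ Ω

/-- The Hilbert space `L²(Ω) × L²(Ω; ℝ^N)` with inner product
`⟪(u, g), (v, k)⟫ = ∫_Ω u v + ∫_Ω g · k`. The map `u ↦ (u, ∇u)` is an isometric embedding of
`H¹(Ω)`, with its standard scalar product, into this space. -/
abbrev L2Pair {N : ℕ} (Ω : Set (RN N)) : Type :=
  WithLp 2 (Lp ℝ 2 (vol Ω) × Lp (RN N) 2 (vol Ω))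

/-- The image of `C_c^∞(Ω)` under `φ ↦ (φ, ∇φ)`. -/
def testPairs {N : ℕ} (Ω : Set (RN N)) : Submodule ℝ (L2Pair Ω) where
  carrier := {p | ∃ φ : RN N → ℝ, IsTestFun Ω φ ∧
    p.fst =ᵐ[vol Ω] φ ∧ p.snd =ᵐ[vol Ω] gradient φ}
  zero_mem' := by
    refine ⟨fun _ => 0, ⟨contDiff_const, ?_, ?_⟩, ?_, ?_⟩
    · exact HasCompactSupport.zero
    · have h : tsupport (fun _ : RN N => (0 : ℝ)) = ∅ := tsupport_eq_empty_iff.mpr rfl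
      simp [h]
    · exact Lp.coeFn_zero ℝ 2 (vol Ω)
    · have h : gradient (fun _ : RN N => (0 : ℝ)) = 0 := by
        funext x; simp [gradient]
      rw [h]
      exact Lp.coeFn_zero (RN N) 2 (vol Ω)
  add_mem' := by
    rintro p q ⟨φ, ⟨hφ, hφc, hφs⟩, hp1, hp2⟩ ⟨ψ, ⟨hψ, hψc, hψs⟩, hq1, hq2⟩
    refine ⟨φ + ψ, ⟨hφ.add hψ, hφc.add hψc, ?_⟩, ?_, ?_⟩
    · exact (tsupport_add φ ψ).trans (Set.union_subset hφs hψs)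
    · exact (Lp.coeFn_add p.fst q.fst).trans (hp1.add hq1)
    · have h : gradient (φ + ψ) = gradient φ + gradient ψ := by
        funext x
        have h1 : DifferentiableAt ℝ φ x := (hφ.differentiable (by simp)).differentiableAt
        have h2 : DifferentiableAt ℝ ψ x := (hψ.differentiable (by simp)).differentiableAt
        simp [gradient, fderiv_add h1 h2]
      rw [h]
      exact (Lp.coeFn_add p.snd q.snd).trans (hp2.add hq2)
  smul_mem' := by
    rintro c p ⟨φ, ⟨hφ, hφc, hφs⟩, hp1, hp2⟩
    refine ⟨c • φ, ⟨contDiff_const.smul hφ, hφc.smul_left, ?_⟩, ?_, ?_⟩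
    · exact (closure_mono (Function.support_const_smul_subset c φ)).trans hφs
    · exact (Lp.coeFn_smul c p.fst).trans (hp1.const_smul c)
    · have h : gradient (c • φ) = c • gradient φ := by
        funext x
        have h1 : DifferentiableAt ℝ φ x := (hφ.differentiable (by simp)).differentiableAt
        simp [gradient, fderiv_const_smul h1 c]
      rw [h]
      exact (Lp.coeFn_smul c p.snd).trans (hp2.const_smul c)

/-- The Sobolev space `H₀¹(Ω)`: the closure of `C_c^∞(Ω)` in the `H¹` norm. An element is the pair
consisting of a function in `L²(Ω)` and of its weak gradient in `L²(Ω; ℝ^N)`: the pairs `(u, g)`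
for which there are test functions `φ_n` with `φ_n → u` and `∇φ_n → g` in `L²`. -/
abbrev H10 {N : ℕ} (Ω : Set (RN N)) : Type := (testPairs Ω).topologicalClosure

/-- The function underlying an element of `H₀¹(Ω)`. -/
def H10.fn {N : ℕ} {Ω : Set (RN N)} (u : H10 Ω) : RN N → ℝ := (u : L2Pair Ω).fst

/-- The weak gradient of an element of `H₀¹(Ω)`. -/
def H10.grad {N : ℕ} {Ω : Set (RN N)} (u : H10 Ω) : RN N → RN N := (u : L2Pair Ω).snd

/-- `l` is an eigenvalue of the Dirichlet Laplacian on `Ω`: the problem `-Δu = l u` in `Ω`,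
`u = 0` on `∂Ω`, has a nonzero weak solution. -/
def IsDirichletEigenvalue {N : ℕ} (Ω : Set (RN N)) (l : ℝ) : Prop :=
  ∃ u : H10 Ω, u ≠ 0 ∧ ∀ v : H10 Ω,
    ∫ x, inner ℝ (u.grad x) (v.grad x) ∂(vol Ω) = l * ∫ x, u.fn x * v.fn x ∂(vol Ω)

/-- The first eigenvalue `λ₁(Ω)` of the Dirichlet Laplacian. -/
def firstEigenvalue {N : ℕ} (Ω : Set (RN N)) : ℝ := sInf {l : ℝ | IsDirichletEigenvalue Ω l}

/-- `a = (a_0, …, a_m)` is an `m`-decomposition of `d`: `0 = a_0 < a_1 < ⋯ < a_m = d`. -/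
structure IsDecomposition (m d : ℕ) (a : Fin (m + 1) → ℕ) : Prop where
  first : a 0 = 0
  last : a (Fin.last m) = d
  strictMono : StrictMono a

/-- The groups of indices. Groups are indexed by `h = 0, …, m - 1` and components by
`i = 0, …, d - 1`, so that `{i ∈ {1, …, d} : a_{h-1} < i ≤ a_h}` becomes `a_h ≤ i < a_{h+1}`. -/
def group {m d : ℕ} (a : Fin (m + 1) → ℕ) (h : Fin m) : Finset (Fin d) :=
  Finset.univ.filter fun i => a h.castSucc ≤ (i : ℕ) ∧ (i : ℕ) < a h.succ

/-- Pairs of distinct indices in the same group. -/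
def K1 {m : ℕ} (d : ℕ) (a : Fin (m + 1) → ℕ) : Set (Fin d × Fin d) :=
  {p | p.1 ≠ p.2 ∧ ∃ h : Fin m, p.1 ∈ group a h ∧ p.2 ∈ group a h}

/-- Pairs of indices in different groups. -/
def K2 {m : ℕ} (d : ℕ) (a : Fin (m + 1) → ℕ) : Set (Fin d × Fin d) :=
  {p | ∃ h k : Fin m, h ≠ k ∧ p.1 ∈ group a h ∧ p.2 ∈ group a k}

/-- The basic assumptions on the potentials `V_i` and the couplings `β_ij`. -/
structure BasicAssumptions {N d : ℕ} (Ω : Set (RN N)) (V : Fin d → RN N → ℝ)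
    (β : Fin d → Fin d → RN N → ℝ) : Prop where
  V_bdd : ∀ i, MemLp (V i) ⊤ (vol Ω)
  β_bdd : ∀ i j, MemLp (β i j) ⊤ (vol Ω)
  β_symm : ∀ i j, i ≠ j → β i j =ᵐ[vol Ω] β j i
  V_lower : ∀ i, ∃ l : ℝ, -firstEigenvalue Ω < l ∧ ∀ᵐ x ∂(vol Ω), l ≤ V i x
  β_diag : ∀ i, ∃ μ : ℝ, 0 < μ ∧ ∀ᵐ x ∂(vol Ω), μ ≤ β i i x

variable {N d m : ℕ} {Ω : Set (RN N)}

/-- `‖u‖_W² = ∫_Ω (|∇u|² + W u²)`. -/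
def normSq (W : RN N → ℝ) (u : H10 Ω) : ℝ :=
  ∫ x, (‖u.grad x‖ ^ 2 + W x * u.fn x ^ 2) ∂(vol Ω)

/-- `‖u_h‖_h² = ∑_{i ∈ I_h} ‖u_i‖_i²`. -/
def groupNormSq (a : Fin (m + 1) → ℕ) (V : Fin d → RN N → ℝ) (u : Fin d → H10 Ω) (h : Fin m) :
    ℝ :=
  ∑ i ∈ group a h, normSq (V i) (u i)

/-- The energy functional `J_{V,B}` on `(H₀¹(Ω))^d`. -/
def energy (V : Fin d → RN N → ℝ) (β : Fin d → Fin d → RN N → ℝ) (u : Fin d → H10 Ω) : ℝ :=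
  (1 / 2) * ∫ x, (∑ i, (‖(u i).grad x‖ ^ 2 + V i x * (u i).fn x ^ 2)) ∂(vol Ω)
    - (1 / 4) * ∫ x, (∑ i, ∑ j, β i j x * (u i).fn x ^ 2 * (u j).fn x ^ 2) ∂(vol Ω)

/-- The `m × m` matrix `M(B, u)`. -/
def couplingMatrix (a : Fin (m + 1) → ℕ) (β : Fin d → Fin d → RN N → ℝ) (u : Fin d → H10 Ω) :
    Matrix (Fin m) (Fin m) ℝ :=
  Matrix.of fun h k =>
    ∑ i ∈ group a h, ∑ j ∈ group a k, ∫ x, β i j x * (u i).fn x ^ 2 * (u j).fn x ^ 2 ∂(vol Ω)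

/-- `∂_i J_{V,B}(u) v`: the derivative of the energy at `u` in the direction which has `v` as
`i`-th component and vanishing other components. -/
def partialEnergy (V : Fin d → RN N → ℝ) (β : Fin d → Fin d → RN N → ℝ) (i : Fin d)
    (u : Fin d → H10 Ω) (v : H10 Ω) : ℝ :=
  lineDeriv ℝ (energy V β) u (Pi.single i v)

/-- The Nehari-type set `N_{V,B}`. -/
def nehari (Ω : Set (RN N)) (a : Fin (m + 1) → ℕ) (V : Fin d → RN N → ℝ)
    (β : Fin d → Fin d → RN N → ℝ) : Set (Fin d → H10 Ω) :=
  {u | ∀ h : Fin m, groupNormSq a V u h ≠ 0 ∧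
    ∑ i ∈ group a h, partialEnergy V β i u (u i) = 0}

/-- Strict diagonal dominance of a square matrix. -/
def StrictDiagDominant (A : Matrix (Fin m) (Fin m) ℝ) : Prop :=
  ∀ h, ∑ k ∈ Finset.univ.erase h, |A h k| < |A h h|

/-- The set `E_B`. -/
def domSet (Ω : Set (RN N)) (a : Fin (m + 1) → ℕ) (β : Fin d → Fin d → RN N → ℝ) :
    Set (Fin d → H10 Ω) :=
  {u | StrictDiagDominant (couplingMatrix a β u)}

end NehariSystem

end

noncomputable section

namespace NehariSystem

open Filter Topology
open scoped ENNReal NNReal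

variable {N d m : ℕ} {Ω : Set (RN N)}

/-! Write X_h(u) for the squared norm of group h and M(u) for the coupling matrix. Differentiating J
along one component turns the constraints into X_h(u) = sum_k M_hk(u), with X_h(u) ≠ 0
(`mem_nehari_iff`), and then J(u) = (1/4) sum_h X_h(u) on N.

Membership in E: since V_i > -λ₁(Ω) uniformly, the quadratic forms are coercive (`exists_coercive`),
so X_h > 0 on N and every row sum of M is positive. The off-diagonal entries are nonpositive because
groups compete, and such a matrix is strictly diagonally dominant. Hence all of N lies in E, not
only the minimizers (`nehari_subset_domSet`).

Existence: X_h ≤ M_hh ≤ K X_h² on N keeps X_h away from zero. A minimizing sequence is bounded; let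
w be a weak limit. Since H₀¹(Ω) embeds compactly in L⁴(Ω) for N ≤ 3, the row sums converge, while
the norms are only lower semicontinuous: the row sums of M(w) are positive and X_h(w) ≤ sum_k
M_hk(w). The limit w may thus leave N, but it can be projected back without raising the energy:
multiplying group h by √s_h lands in N as soon as M(w) s = X(w). A matrix with nonpositive
off-diagonal entries and positive row sums is inverse-positive, so s is positive, and the inequality
X ≤ M·1 gives s ≤ 1 (`exists_pos_solution`). The projected vector has energy (1/4) sum_h s_h X_h(w),
at most the infimum. The same projection, applied to bumps with disjoint supports, shows that N is
nonempty.

The analytic input consists of the Sobolev inequality into L⁶, the Rellich theorem obtained by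
averaging over small balls, and the variational characterization of λ₁(Ω). -/

/-! ### Weak compactness and an L² estimate for translations. -/

/-- Weak sequential compactness of bounded sets in a separable Hilbert space. -/
theorem exists_subseq_tendsto_inner {H : Type*} [NormedAddCommGroup H] [InnerProductSpace ℝ H]
    [CompleteSpace H] [TopologicalSpace.SeparableSpace H] (u : ℕ → H) (R : ℝ)
    (hu : ∀ n, ‖u n‖ ≤ R) :
    ∃ w : H, ∃ φ : ℕ → ℕ, StrictMono φ ∧
      ∀ v, Tendsto (fun n => inner ℝ (u (φ n)) v) atTop (𝓝 (inner ℝ w v)) := by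
  -- The Riesz isometry carries the sequence into a closed ball of the dual, which is weak-*
  -- sequentially compact because `H` is separable.
  let ι : H → WeakDual ℝ H := fun v => StrongDual.toWeakDual (InnerProductSpace.toDual ℝ H v)
  have hs := WeakDual.isSeqCompact_closedBall ℝ H (0 : StrongDual ℝ H) R
  obtain ⟨f, -, φ, hφ, hf⟩ := hs (x := fun n => ι (u n)) (fun n => by
    simp only [ι, Set.mem_preimage, mem_closedBall_zero_iff]
    exact ((InnerProductSpace.toDual ℝ H).norm_map (u n)).le.trans (hu n))
  refine ⟨(InnerProductSpace.toDual ℝ H).symm (WeakDual.toStrongDual f), φ, hφ, fun v => ?_⟩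
  have h := (WeakDual.eval_continuous (𝕜 := ℝ) v).continuousAt.tendsto.comp hf
  rw [InnerProductSpace.toDual_symm_apply]
  exact h

theorem sq_lintegral_le_lintegral_sq {α : Type*} [MeasurableSpace α] {μ : Measure α}
    [IsProbabilityMeasure μ] {f : α → ℝ≥0∞} (hf : AEMeasurable f μ) :
    (∫⁻ x, f x ∂μ) ^ 2 ≤ ∫⁻ x, f x ^ 2 ∂μ := by
  have h := ENNReal.lintegral_mul_le_Lp_mul_Lq μ Real.HolderConjugate.two_two hf
    (aemeasurable_const (b := (1 : ℝ≥0∞)))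
  simp only [Pi.mul_apply, mul_one, ENNReal.one_rpow, lintegral_const, measure_univ] at h
  calc (∫⁻ x, f x ∂μ) ^ 2 ≤ ((∫⁻ x, f x ^ (2 : ℝ) ∂μ) ^ (1 / 2 : ℝ)) ^ 2 := by gcongr
    _ = ∫⁻ x, f x ^ 2 ∂μ := by
      rw [← ENNReal.rpow_natCast, ← ENNReal.rpow_mul]
      norm_num

/-- Translations are Lipschitz in `L²` on functions with square integrable derivative. -/
theorem lintegral_sq_translate_sub_le {E : Type*} [NormedAddCommGroup E] [NormedSpace ℝ E]
    [MeasurableSpace E] [BorelSpace E] [SecondCountableTopology E] (μ : Measure E)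
    [SFinite μ] [μ.IsAddRightInvariant] {φ : E → ℝ} (hφ : ContDiff ℝ 1 φ) (h : E) :
    ∫⁻ x, ‖φ (x + h) - φ x‖ₑ ^ 2 ∂μ ≤ ‖h‖ₑ ^ 2 * ∫⁻ x, ‖fderiv ℝ φ x‖ₑ ^ 2 ∂μ := by
  have hc : Continuous (fderiv ℝ φ) := hφ.continuous_fderiv one_ne_zero
  -- Fundamental theorem of calculus along the segment from x to x + h, then Jensen in t.
  -- Integrating in x and swapping the integrals, translation invariance removes the shift t h.
  have hpt : ∀ x, ‖φ (x + h) - φ x‖ₑ ^ 2 ≤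
      ∫⁻ t in Set.Ioc (0 : ℝ) 1, ‖h‖ₑ ^ 2 * ‖fderiv ℝ φ (x + t • h)‖ₑ ^ 2 := by
    intro x
    have hder : ∀ t : ℝ, HasDerivAt (fun t : ℝ => φ (x + t • h)) (fderiv ℝ φ (x + t • h) h) t := by
      intro t
      have h1 : HasDerivAt (fun t : ℝ => x + t • h) h t := by
        simpa using ((hasDerivAt_id t).smul_const h).const_add x
      exact ((hφ.differentiable one_ne_zero _).hasFDerivAt).comp_hasDerivAt t h1
    have hcont : Continuous fun t : ℝ => fderiv ℝ φ (x + t • h) h := by fun_prop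
    have hftc := intervalIntegral.integral_eq_sub_of_hasDerivAt (a := 0) (b := 1)
      (fun t _ => hder t) (hcont.intervalIntegrable 0 1)
    simp only [one_smul, zero_smul, add_zero] at hftc
    rw [← hftc, intervalIntegral.integral_of_le zero_le_one]
    have : IsProbabilityMeasure (volume.restrict (Set.Ioc (0 : ℝ) 1)) := ⟨by simp⟩
    calc _ ≤ (∫⁻ t in Set.Ioc (0 : ℝ) 1, ‖fderiv ℝ φ (x + t • h) h‖ₑ) ^ 2 := by
          gcongr; exact enorm_integral_le_lintegral_enorm _
      _ ≤ ∫⁻ t in Set.Ioc (0 : ℝ) 1, ‖fderiv ℝ φ (x + t • h) h‖ₑ ^ 2 :=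
          sq_lintegral_le_lintegral_sq hcont.enorm.measurable.aemeasurable
      _ ≤ _ := by
          gcongr with t
          rw [← mul_pow, mul_comm]
          gcongr
          exact ContinuousLinearMap.le_opENorm _ _
  calc _ ≤ ∫⁻ x, (∫⁻ t in Set.Ioc (0 : ℝ) 1, ‖h‖ₑ ^ 2 * ‖fderiv ℝ φ (x + t • h)‖ₑ ^ 2) ∂μ :=
        lintegral_mono hpt
    _ = ∫⁻ t in Set.Ioc (0 : ℝ) 1, ∫⁻ x, ‖h‖ₑ ^ 2 * ‖fderiv ℝ φ (x + t • h)‖ₑ ^ 2 ∂μ := by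
        refine lintegral_lintegral_swap ?_
        have : Measurable fun p : E × ℝ => ‖h‖ₑ ^ 2 * ‖fderiv ℝ φ (p.1 + p.2 • h)‖ₑ ^ 2 := by
          have : Continuous fun p : E × ℝ => fderiv ℝ φ (p.1 + p.2 • h) := by fun_prop
          exact (this.enorm.measurable.pow_const 2).const_mul _
        exact this.aemeasurable
    _ = ∫⁻ t in Set.Ioc (0 : ℝ) 1, ‖h‖ₑ ^ 2 * ∫⁻ x, ‖fderiv ℝ φ x‖ₑ ^ 2 ∂μ := by
        congr 1
        funext t
        rw [lintegral_const_mul _ (by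
          have : Continuous fun x => fderiv ℝ φ (x + t • h) := by fun_prop
          exact this.enorm.measurable.pow_const 2)]
        rw [lintegral_add_right_eq_self (fun x => ‖fderiv ℝ φ x‖ₑ ^ 2) (t • h)]
    _ = _ := by simp

/-! ### Matrices with nonpositive off-diagonal entries and positive row sums. -/

section MMatrix

variable {A : Matrix (Fin m) (Fin m) ℝ}

/-- The off-diagonal entries have a known sign, so a positive row sum says exactly that the diagonal
entry exceeds the sum of their absolute values. -/
theorem StrictDiagDominant.of_row_sum_pos (hoff : ∀ h k, h ≠ k → A h k ≤ 0)
    (hrow : ∀ h, 0 < ∑ k, A h k) : StrictDiagDominant A := by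
  intro h
  have h1 := hrow h
  rw [← Finset.add_sum_erase _ _ (Finset.mem_univ h)] at h1
  have h2 : ∑ k ∈ Finset.univ.erase h, |A h k| = - ∑ k ∈ Finset.univ.erase h, A h k := by
    rw [← Finset.sum_neg_distrib]
    refine Finset.sum_congr rfl fun k hk => abs_of_nonpos (hoff h k ?_)
    exact (Finset.ne_of_mem_erase hk).symm
  rw [h2]
  exact lt_of_lt_of_le (by linarith) (le_abs_self _)

/-- Matrices with nonpositive off-diagonal entries and positive row sums are monotone. -/
theorem nonneg_of_mulVec_nonneg (hoff : ∀ h k, h ≠ k → A h k ≤ 0)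
    (hrow : ∀ h, 0 < ∑ k, A h k) {s : Fin m → ℝ} (hs : ∀ h, 0 ≤ (A.mulVec s) h) (h : Fin m) :
    0 ≤ s h := by
  have : Nonempty (Fin m) := ⟨h⟩
  -- Discrete minimum principle: at an index k where s is minimal, (A s)_k is at most the row sum
  -- times s_k, which is negative if s_k is.
  obtain ⟨k, hk⟩ := Finite.exists_min s
  refine le_trans ?_ (hk h)
  by_contra hneg
  push Not at hneg
  have h1 : (A.mulVec s) k ≤ (∑ l, A k l) * s k := by
    rw [Matrix.mulVec, dotProduct, Finset.sum_mul]
    refine Finset.sum_le_sum fun l _ => ?_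
    rcases eq_or_ne k l with rfl | hkl
    · exact le_rfl
    · exact mul_le_mul_of_nonpos_left (hk l) (hoff k l hkl)
  have := mul_neg_of_pos_of_neg (hrow k) hneg
  linarith [hs k]

/-- The solution of `A s = b` for a positive right-hand side is positive, and it is at most one if
the right-hand side is dominated by the row sums. -/
theorem exists_pos_solution (hoff : ∀ h k, h ≠ k → A h k ≤ 0) {b : Fin m → ℝ}
    (hb : ∀ h, 0 < b h) (hrow : ∀ h, 0 < ∑ k, A h k) :
    ∃ s : Fin m → ℝ, (∀ h, 0 < s h) ∧ A.mulVec s = b ∧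
      ((∀ h, b h ≤ ∑ k, A h k) → ∀ h, s h ≤ 1) := by
  have hdet : A.det ≠ 0 := det_ne_zero_of_sum_row_lt_diag (by
    simpa only [Real.norm_eq_abs, StrictDiagDominant] using
      StrictDiagDominant.of_row_sum_pos hoff hrow)
  have hsol : A.mulVec (A⁻¹.mulVec b) = b := by
    rw [Matrix.mulVec_mulVec, Matrix.mul_nonsing_inv _ (isUnit_iff_ne_zero.mpr hdet),
      Matrix.one_mulVec]
  generalize A⁻¹.mulVec b = s at hsol
  have hs0 : ∀ h, 0 ≤ s h := nonneg_of_mulVec_nonneg hoff hrow (by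
    rw [hsol]; exact fun h => (hb h).le)
  refine ⟨s, fun h => (hs0 h).lt_of_ne fun h0 => ?_, hsol, fun hle h => ?_⟩
  · have h1 : (A.mulVec s) h ≤ 0 := by
      rw [Matrix.mulVec, dotProduct]
      refine Finset.sum_nonpos fun l _ => ?_
      rcases eq_or_ne h l with rfl | hl
      · rw [← h0, mul_zero]
      · exact mul_nonpos_of_nonpos_of_nonneg (hoff h l hl) (hs0 l)
    rw [hsol] at h1
    exact absurd h1 (hb h).not_ge
  -- A (1 - s) is the vector of row sums minus b, so monotonicity applies to 1 - s.
  · have h1 := nonneg_of_mulVec_nonneg hoff hrow (s := 1 - s) (fun k => by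
      rw [Matrix.mulVec_sub, hsol]
      simpa [Matrix.mulVec, dotProduct] using hle k) h
    simpa using h1

end MMatrix

/-! ### Test functions and the Sobolev inequality. -/

theorem norm_gradient {E : Type*} [NormedAddCommGroup E] [InnerProductSpace ℝ E]
    [CompleteSpace E] (φ : E → ℝ) (x : E) : ‖gradient φ x‖ = ‖fderiv ℝ φ x‖ :=
  (InnerProductSpace.toDual ℝ E).symm.norm_map _

theorem IsTestFun.support_subset {φ : RN N → ℝ} (hφ : IsTestFun Ω φ) :
    Function.support φ ⊆ Ω := (subset_tsupport φ).trans hφ.2.2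

theorem IsTestFun.contDiff_one {φ : RN N → ℝ} (hφ : IsTestFun Ω φ) : ContDiff ℝ 1 φ :=
  hφ.1.of_le (by exact_mod_cast le_top)

theorem IsTestFun.continuous_fderiv {φ : RN N → ℝ} (hφ : IsTestFun Ω φ) :
    Continuous (fderiv ℝ φ) := hφ.contDiff_one.continuous_fderiv one_ne_zero

theorem IsTestFun.continuous_gradient {φ : RN N → ℝ} (hφ : IsTestFun Ω φ) :
    Continuous (gradient φ) :=
  (InnerProductSpace.toDual ℝ (RN N)).symm.continuous.comp hφ.continuous_fderiv

theorem IsTestFun.support_fderiv_subset {φ : RN N → ℝ} (hφ : IsTestFun Ω φ) :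
    Function.support (fderiv ℝ φ) ⊆ Ω := (_root_.support_fderiv_subset ℝ).trans hφ.2.2

theorem IsTestFun.eLpNorm_fderiv {φ : RN N → ℝ} (hφ : IsTestFun Ω φ) (p : ℝ≥0∞) :
    eLpNorm (fderiv ℝ φ) p volume = eLpNorm (gradient φ) p (vol Ω) := by
  rw [← eLpNorm_restrict_eq_of_support_subset (f := fderiv ℝ φ) hφ.support_fderiv_subset]
  exact eLpNorm_congr_norm_ae (Eventually.of_forall fun x => (norm_gradient φ x).symm)

/-- In dimension one, a test function is bounded by the `L¹` norm of its derivative. -/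
theorem enorm_le_lintegral_fderiv_of_dim_one {φ : RN 1 → ℝ} (hφ : ContDiff ℝ 1 φ)
    (hc : HasCompactSupport φ) (x : RN 1) : ‖φ x‖ₑ ≤ ∫⁻ y, ‖fderiv ℝ φ y‖ₑ := by
  let b := OrthonormalBasis.singleton (Fin 1) ℝ
  let e : ℝ ≃ₗᵢ[ℝ] RN 1 := b.repr
  have hmp : MeasurePreserving e volume volume := b.measurePreserving_repr
  have hemb : MeasurableEmbedding e := e.toHomeomorph.measurableEmbedding
  obtain ⟨t, rfl⟩ := e.surjective x
  have h1 : ContDiff ℝ 1 (φ ∘ e) := hφ.comp e.contDiff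
  have h2 : HasCompactSupport (φ ∘ e) := hc.comp_homeomorph e.toHomeomorph
  calc ‖φ (e t)‖ₑ = ‖(φ ∘ e) t‖ₑ := rfl
    _ ≤ ∫⁻ y in Set.Iic t, ‖deriv (φ ∘ e) y‖ₑ := h2.enorm_le_lintegral_Ici_deriv h1 t
    _ ≤ ∫⁻ y, ‖deriv (φ ∘ e) y‖ₑ := setLIntegral_le_lintegral _ _
    _ ≤ ∫⁻ y, ‖fderiv ℝ φ (e y)‖ₑ := by
      gcongr with y
      have hd : HasDerivAt (φ ∘ e) (fderiv ℝ φ (e y) (e 1)) y := by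
        have he : HasDerivAt e (e 1) y :=
          (e.toContinuousLinearEquiv : ℝ →L[ℝ] RN 1).hasDerivAt
        exact (hφ.differentiable one_ne_zero _).hasFDerivAt.comp_hasDerivAt y he
      rw [hd.deriv]
      refine (ContinuousLinearMap.le_opENorm _ _).trans ?_
      have : ‖e 1‖ₑ = 1 := by
        rw [← ofReal_norm, e.norm_map]; simp
      rw [this, mul_one]
    _ = ∫⁻ y, ‖fderiv ℝ φ y‖ₑ := hmp.lintegral_comp_emb hemb (fun y => ‖fderiv ℝ φ y‖ₑ)

/-- The Sobolev inequality `‖φ‖_{L⁶} ≤ C ‖∇φ‖_{L²}` on a bounded set of dimension at most three. -/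
theorem exists_eLpNorm_six_le (hN1 : 1 ≤ N) (hN3 : N ≤ 3) (hΩb : Bornology.IsBounded Ω) :
    ∃ C : ℝ≥0, ∀ φ : RN N → ℝ, IsTestFun Ω φ →
      eLpNorm φ 6 (vol Ω) ≤ C * eLpNorm (gradient φ) 2 (vol Ω) := by
  have hfin : (vol Ω) Set.univ < ⊤ := by
    rw [Measure.restrict_apply_univ]; exact hΩb.measure_lt_top
  have hpow : ∀ {r : ℝ}, 0 ≤ r → (vol Ω) Set.univ ^ r ≠ ⊤ := fun hr =>
    ENNReal.rpow_ne_top_of_nonneg hr hfin.ne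
  -- In dimension 1 the sup norm is bounded by the L¹ norm of the derivative. In dimension 2 the
  -- exponent 2 is critical, so 3/2 is used, whose Sobolev conjugate is 6. In dimension 3 the
  -- conjugate of 2 is 6. Hölder on the bounded set Ω restores the L² norm of the gradient in the
  -- first two cases.
  obtain rfl | rfl | rfl : N = 1 ∨ N = 2 ∨ N = 3 := by omega
  · refine ⟨((vol Ω) Set.univ ^ (1 / (1 : ℝ≥0∞).toReal - 1 / (2 : ℝ≥0∞).toReal)).toNNReal *
      ((vol Ω) Set.univ ^ ((6 : ℝ≥0∞).toReal⁻¹)).toNNReal, fun φ hφ => ?_⟩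
    rw [ENNReal.coe_mul, ENNReal.coe_toNNReal (hpow (by norm_num)),
      ENNReal.coe_toNNReal (hpow (by norm_num))]
    have h1 : ∀ x, ‖φ x‖ₑ ≤ eLpNorm (gradient φ) 1 (vol Ω) := fun x => by
      rw [← hφ.eLpNorm_fderiv, eLpNorm_one_eq_lintegral_enorm]
      exact enorm_le_lintegral_fderiv_of_dim_one hφ.contDiff_one hφ.2.1 x
    refine (eLpNorm_le_of_ae_enorm_bound (Eventually.of_forall h1)).trans ?_
    rw [smul_eq_mul, mul_comm _ (eLpNorm (gradient φ) 2 (vol Ω)), ← mul_assoc]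
    gcongr
    exact eLpNorm_le_eLpNorm_mul_rpow_measure_univ (by norm_num)
      hφ.continuous_gradient.aestronglyMeasurable
  · refine ⟨eLpNormLESNormFDerivOfLeConst ℝ (volume : Measure (RN 2)) Ω (3 / 2) 6 *
      ((vol Ω) Set.univ ^ (1 / ((3 / 2 : ℝ≥0) : ℝ≥0∞).toReal - 1 / (2 : ℝ≥0∞).toReal)).toNNReal,
      fun φ hφ => ?_⟩
    rw [eLpNorm_restrict_eq_of_support_subset hφ.support_subset]
    have hs := eLpNorm_le_eLpNorm_fderiv_of_le (volume : Measure (RN 2)) hφ.contDiff_one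
      hφ.support_subset (p := 3 / 2) (q := 6)
      (by rw [← NNReal.coe_le_coe]; norm_num)
      (by rw [← NNReal.coe_lt_coe]; simp; norm_num) (by simp; norm_num) hΩb
    refine hs.trans ?_
    rw [hφ.eLpNorm_fderiv, ENNReal.coe_mul, mul_assoc]
    gcongr
    rw [ENNReal.coe_toNNReal (hpow (by norm_num)), mul_comm]
    refine eLpNorm_le_eLpNorm_mul_rpow_measure_univ ?_
      hφ.continuous_gradient.aestronglyMeasurable
    have : (3 / 2 : ℝ≥0) ≤ 2 := by rw [← NNReal.coe_le_coe]; norm_num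
    exact_mod_cast this
  · refine ⟨eLpNormLESNormFDerivOfLeConst ℝ (volume : Measure (RN 3)) Ω 2 6, fun φ hφ => ?_⟩
    rw [eLpNorm_restrict_eq_of_support_subset hφ.support_subset, ← hφ.eLpNorm_fderiv]
    exact eLpNorm_le_eLpNorm_fderiv_of_le (volume : Measure (RN 3)) hφ.contDiff_one
      hφ.support_subset (p := 2) (q := 6) (by norm_num)
      (by rw [← NNReal.coe_lt_coe]; simp; norm_num) (by simp; norm_num) hΩb

/-! ### Local means: the quantitative estimate behind the Rellich theorem. -/

theorem sq_enorm_add_le (x y : ℝ) : ‖x + y‖ₑ ^ 2 ≤ 2 * ‖x‖ₑ ^ 2 + 2 * ‖y‖ₑ ^ 2 := by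
  have h : ∀ z : ℝ, ‖z‖ₑ ^ 2 = ENNReal.ofReal (z ^ 2) := fun z => by
    rw [← ofReal_norm, ← ENNReal.ofReal_pow (norm_nonneg _), Real.norm_eq_abs, sq_abs]
  have h2 : (2 : ℝ≥0∞) = ENNReal.ofReal 2 := by simp
  rw [h, h, h, h2, ← ENNReal.ofReal_mul zero_le_two, ← ENNReal.ofReal_mul zero_le_two,
    ← ENNReal.ofReal_add (by positivity) (by positivity)]
  exact ENNReal.ofReal_le_ofReal (by nlinarith [sq_nonneg (x - y)])

/-- The square of a continuous function at a point of a ball is controlled by its increments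
and by its mean over the ball. -/
theorem sq_enorm_le_lintegral_translate {φ : RN N → ℝ} (hφ : Continuous φ) {ε : ℝ} (hε : 0 < ε)
    {x y : RN N} (hx : x ∈ Metric.ball y ε) :
    ‖φ x‖ₑ ^ 2 ≤ 2 * ((volume (Metric.ball (0 : RN N) ε))⁻¹ *
        ∫⁻ h in Metric.ball (0 : RN N) (2 * ε), ‖φ (x + h) - φ x‖ₑ ^ 2) +
      2 * ((volume (Metric.ball (0 : RN N) ε))⁻¹ ^ 2 *
        ‖∫ z in Metric.ball y ε, φ z‖ₑ ^ 2) := by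
  set b := volume (Metric.ball (0 : RN N) ε) with hb
  have hby : volume (Metric.ball y ε) = b := Measure.addHaar_ball_center _ _ _
  have hb0 : b ≠ 0 := (Metric.measure_ball_pos _ _ hε).ne'
  have hbt : b ≠ ⊤ := measure_ball_lt_top.ne
  -- Averaging over the ball with a probability measure splits φ(x) into the mean of φ(x) - φ(z),
  -- estimated by Jensen, and the mean of φ.
  set ν := b⁻¹ • (volume : Measure (RN N)).restrict (Metric.ball y ε) with hν
  have hprob : IsProbabilityMeasure ν := ⟨by simp [hν, hby, ENNReal.inv_mul_cancel hb0 hbt]⟩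
  have hint : IntegrableOn φ (Metric.ball y ε) volume :=
    (hφ.continuousOn.integrableOn_compact (isCompact_closedBall y ε)).mono_set Metric.ball_subset_closedBall
  have hint' : Integrable φ ν := hint.smul_measure (ENNReal.inv_ne_top.2 hb0)
  have hsplit : φ x = ∫ z, (φ x - φ z) ∂ν + ∫ z, φ z ∂ν := by
    rw [integral_sub (integrable_const _) hint']; simp
  have h1 : ‖∫ z, (φ x - φ z) ∂ν‖ₑ ^ 2 ≤ b⁻¹ *
      ∫⁻ h in Metric.ball (0 : RN N) (2 * ε), ‖φ (x + h) - φ x‖ₑ ^ 2 := by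
    calc _ ≤ (∫⁻ z, ‖φ x - φ z‖ₑ ∂ν) ^ 2 := by
          gcongr; exact enorm_integral_le_lintegral_enorm _
      _ ≤ ∫⁻ z, ‖φ x - φ z‖ₑ ^ 2 ∂ν := sq_lintegral_le_lintegral_sq
          (continuous_const.sub hφ).enorm.measurable.aemeasurable
      _ = b⁻¹ * ∫⁻ z in Metric.ball y ε, ‖φ x - φ z‖ₑ ^ 2 := by
          rw [hν, lintegral_smul_measure, smul_eq_mul]
      -- Substitute z = x + h: both x and z lie in a ball of radius ε, hence |h| < 2ε.
      _ ≤ b⁻¹ * ∫⁻ h in Metric.ball (0 : RN N) (2 * ε), ‖φ (x + h) - φ x‖ₑ ^ 2 := by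
          gcongr b⁻¹ * ?_
          rw [← lintegral_indicator measurableSet_ball, ← lintegral_indicator measurableSet_ball,
            ← lintegral_add_left_eq_self _ x]
          gcongr with h
          simp only [Set.indicator]
          split_ifs with h1 h2 h2
          · rw [← enorm_neg, neg_sub]
          · exfalso
            refine h2 ?_
            rw [mem_ball_zero_iff]
            rw [mem_ball_iff_norm] at h1 hx
            calc ‖h‖ = ‖(x + h - y) - (x - y)‖ := by congr 1; abel
              _ ≤ ‖x + h - y‖ + ‖x - y‖ := norm_sub_le _ _
              _ < 2 * ε := by linarith
          · exact zero_le
          · exact le_rfl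
  have h2 : ‖∫ z, φ z ∂ν‖ₑ ^ 2 = b⁻¹ ^ 2 * ‖∫ z in Metric.ball y ε, φ z‖ₑ ^ 2 := by
    rw [hν, integral_smul_measure, enorm_smul, mul_pow]
    congr 2
    rw [Real.enorm_of_nonneg ENNReal.toReal_nonneg,
      ENNReal.ofReal_toReal (ENNReal.inv_ne_top.2 hb0)]
  calc ‖φ x‖ₑ ^ 2 ≤ 2 * ‖∫ z, (φ x - φ z) ∂ν‖ₑ ^ 2 + 2 * ‖∫ z, φ z ∂ν‖ₑ ^ 2 := by
        conv_lhs => rw [hsplit]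
        exact sq_enorm_add_le _ _
    _ ≤ _ := by rw [h2]; gcongr

/-- The `L²` norm of a test function is controlled by a small multiple of the norm of its gradient
and by finitely many local means. -/
theorem IsTestFun.lintegral_sq_le {φ : RN N → ℝ} (hφ : IsTestFun Ω φ) (hΩo : IsOpen Ω)
    {ε : ℝ} (hε : 0 < ε) {t : Finset (RN N)} (ht : Ω ⊆ ⋃ y ∈ t, Metric.ball y ε) :
    ∫⁻ x in Ω, ‖φ x‖ₑ ^ 2 ≤
      2 * (2 ^ N * (ENNReal.ofReal (2 * ε) ^ 2 * ∫⁻ x in Ω, ‖gradient φ x‖ₑ ^ 2)) +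
      2 * (volume (Metric.ball (0 : RN N) ε))⁻¹ ^ 2 * volume Ω *
        ∑ y ∈ t, ‖∫ z in Metric.ball y ε, φ z ∂(vol Ω)‖ₑ ^ 2 := by
  set b := volume (Metric.ball (0 : RN N) ε) with hb
  have hb0 : b ≠ 0 := (Metric.measure_ball_pos _ _ hε).ne'
  have hbt : b ≠ ⊤ := measure_ball_lt_top.ne
  have hcont : Continuous φ := hφ.1.continuous
  have hloc : ∀ y, ∫ z in Metric.ball y ε, φ z = ∫ z in Metric.ball y ε, φ z ∂(vol Ω) := by
    intro y
    rw [vol, Measure.restrict_restrict measurableSet_ball, Set.inter_comm,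
      ← Measure.restrict_restrict hΩo.measurableSet]
    refine (setIntegral_eq_integral_of_forall_compl_eq_zero fun x hx => ?_).symm
    exact Function.notMem_support.mp fun h => hx (hφ.support_subset h)
  set S := ∑ y ∈ t, ‖∫ z in Metric.ball y ε, φ z ∂(vol Ω)‖ₑ ^ 2 with hS
  have hgrad : ∫⁻ x, ‖fderiv ℝ φ x‖ₑ ^ 2 = ∫⁻ x in Ω, ‖gradient φ x‖ₑ ^ 2 := by
    have h1 : ∀ x, ‖gradient φ x‖ₑ ^ 2 = ‖fderiv ℝ φ x‖ₑ ^ 2 := fun x => by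
      rw [← ofReal_norm, ← ofReal_norm, norm_gradient]
    simp_rw [h1]
    refine (setLIntegral_eq_of_support_subset fun x hx => ?_).symm
    refine hφ.support_fderiv_subset fun h => hx ?_
    change ‖fderiv ℝ φ x‖ₑ ^ 2 = 0
    rw [h, ← ofReal_norm, norm_zero]
    simp
  have hmeas : Measurable fun p : RN N × RN N => ‖φ (p.1 + p.2) - φ p.1‖ₑ ^ 2 := by
    have : Continuous fun p : RN N × RN N => φ (p.1 + p.2) - φ p.1 := by fun_prop
    exact this.enorm.measurable.pow_const 2
  calc ∫⁻ x in Ω, ‖φ x‖ₑ ^ 2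
      ≤ ∫⁻ x in Ω, (2 * (b⁻¹ * ∫⁻ h in Metric.ball (0 : RN N) (2 * ε), ‖φ (x + h) - φ x‖ₑ ^ 2) +
          2 * (b⁻¹ ^ 2 * S)) := by
        refine setLIntegral_mono' hΩo.measurableSet fun x hx => ?_
        obtain ⟨y, hy, hxy⟩ := Set.mem_iUnion₂.mp (ht hx)
        refine (sq_enorm_le_lintegral_translate hcont hε hxy).trans ?_
        gcongr
        rw [hloc]
        exact Finset.single_le_sum (f := fun y => ‖∫ z in Metric.ball y ε, φ z ∂(vol Ω)‖ₑ ^ 2)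
          (fun _ _ => zero_le) hy
    _ = 2 * (b⁻¹ * ∫⁻ x in Ω, ∫⁻ h in Metric.ball (0 : RN N) (2 * ε), ‖φ (x + h) - φ x‖ₑ ^ 2) +
          2 * (b⁻¹ ^ 2 * S) * volume Ω := by
        have hm := hmeas.lintegral_prod_right' (ν := volume.restrict (Metric.ball (0 : RN N) (2 * ε)))
        rw [lintegral_add_right _ measurable_const, lintegral_const,
          lintegral_const_mul _ (hm.const_mul _), lintegral_const_mul _ hm,
          Measure.restrict_apply_univ]
    -- After Fubini each shift with |h| < 2ε costs at most (2ε)² times the gradient integral. The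
    -- ball of shifts has volume 2^N b, which cancels b⁻¹.
    _ ≤ 2 * (b⁻¹ * (∫⁻ h in Metric.ball (0 : RN N) (2 * ε),
          ENNReal.ofReal (2 * ε) ^ 2 * ∫⁻ x, ‖fderiv ℝ φ x‖ₑ ^ 2)) +
          2 * (b⁻¹ ^ 2 * S) * volume Ω := by
        gcongr 2 * (b⁻¹ * ?_) + _
        rw [lintegral_lintegral_swap hmeas.aemeasurable]
        refine setLIntegral_mono' measurableSet_ball fun h hh => ?_
        refine (setLIntegral_le_lintegral _ _).trans
          ((lintegral_sq_translate_sub_le volume hφ.contDiff_one h).trans ?_)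
        gcongr
        rw [← ofReal_norm]
        exact ENNReal.ofReal_le_ofReal (mem_ball_zero_iff.mp hh).le
    _ = _ := by
        rw [setLIntegral_const, hgrad, Measure.addHaar_ball_mul_of_pos _ _ two_pos, ← hb]
        have hd : ENNReal.ofReal (2 ^ Module.finrank ℝ (RN N)) = 2 ^ N := by
          rw [finrank_euclideanSpace_fin, ENNReal.ofReal_pow zero_le_two]; simp
        rw [hd]
        have hc : b⁻¹ * (ENNReal.ofReal (2 * ε) ^ 2 * (∫⁻ x in Ω, ‖gradient φ x‖ₑ ^ 2) *
            (2 ^ N * b)) = (b⁻¹ * b) * (2 ^ N * (ENNReal.ofReal (2 * ε) ^ 2 *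
              ∫⁻ x in Ω, ‖gradient φ x‖ₑ ^ 2)) := by ring
        rw [hc, ENNReal.inv_mul_cancel hb0 hbt, one_mul]
        ring

/-! ### The Hilbert space H₀¹(Ω) and the passage from test functions to its elements. -/

theorem lintegral_sq_enorm_eq {α E : Type*} [MeasurableSpace α] {μ : Measure α}
    [NormedAddCommGroup E] (f : Lp E 2 μ) : ∫⁻ x, ‖f x‖ₑ ^ 2 ∂μ = ENNReal.ofReal (‖f‖ ^ 2) := by
  have h := eLpNorm_nnreal_pow_eq_lintegral (μ := μ) (f := f) (p := 2) two_ne_zero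
  rw [ENNReal.ofReal_pow (norm_nonneg _), ofReal_norm, Lp.enorm_def]
  simpa using h.symm

/-- The inclusion of `H₀¹(Ω)` in `L²(Ω)`. -/
def fnL (Ω : Set (RN N)) : H10 Ω →L[ℝ] Lp ℝ 2 (vol Ω) :=
  (WithLp.fstL 2 ℝ (Lp ℝ 2 (vol Ω)) (Lp (RN N) 2 (vol Ω))).comp (Submodule.subtypeL _)

/-- The weak gradient on `H₀¹(Ω)` with values in `L²(Ω; ℝ^N)`. -/
def gradL (Ω : Set (RN N)) : H10 Ω →L[ℝ] Lp (RN N) 2 (vol Ω) :=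
  (WithLp.sndL 2 ℝ (Lp ℝ 2 (vol Ω)) (Lp (RN N) 2 (vol Ω))).comp (Submodule.subtypeL _)

theorem H10.fn_eq (u : H10 Ω) : u.fn = fnL Ω u := rfl

theorem H10.norm_sq (u : H10 Ω) : ‖u‖ ^ 2 = ‖fnL Ω u‖ ^ 2 + ‖gradL Ω u‖ ^ 2 :=
  WithLp.prod_norm_sq_eq_of_L2 _

instance : CompleteSpace (H10 Ω) :=
  (Submodule.isClosed_topologicalClosure (testPairs Ω)).completeSpace_coe

instance : TopologicalSpace.SeparableSpace (H10 Ω) := by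
  have : Fact ((2 : ℝ≥0∞) ≠ ⊤) := ⟨by simp⟩
  have h1 : SecondCountableTopology (Lp ℝ 2 (vol Ω)) := inferInstance
  have h2 : SecondCountableTopology (Lp (RN N) 2 (vol Ω)) := inferInstance
  have : SecondCountableTopology (L2Pair Ω) :=
    (WithLp.homeomorphProd 2 _ _).secondCountableTopology
  infer_instance

/-- A closed property of pairs which holds for test functions holds on `H₀¹(Ω)`. -/
theorem H10.induction_closed {P : L2Pair Ω → Prop} (hP : IsClosed {p | P p})
    (h : ∀ p : L2Pair Ω, ∀ φ, IsTestFun Ω φ → p.fst =ᵐ[vol Ω] φ →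
      p.snd =ᵐ[vol Ω] gradient φ → P p) (u : H10 Ω) : P u := by
  have hsub : (testPairs Ω : Set (L2Pair Ω)) ⊆ {p | P p} := by
    rintro p ⟨φ, hφ, h1, h2⟩
    exact h p φ hφ h1 h2
  exact closure_minimal hsub hP u.2

/-- The L^q norm need not be continuous for L² convergence, but along an a.e. convergent subsequence
Fatou's lemma gives lower semicontinuity, which suffices. -/
theorem isClosed_eLpNorm_fst_le (q : ℝ≥0∞) (C : ℝ≥0) :
    IsClosed {p : L2Pair Ω | eLpNorm p.fst q (vol Ω) ≤ C * ‖p.snd‖ₑ} := by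
  refine IsSeqClosed.isClosed fun p l hp hl => ?_
  have h1 : Tendsto (fun n => (p n).fst) atTop (𝓝 l.fst) :=
    ((WithLp.fstL 2 ℝ (Lp ℝ 2 (vol Ω)) (Lp (RN N) 2 (vol Ω))).continuous.tendsto l).comp hl
  have h2 : Tendsto (fun n => (p n).snd) atTop (𝓝 l.snd) :=
    ((WithLp.sndL 2 ℝ (Lp ℝ 2 (vol Ω)) (Lp (RN N) 2 (vol Ω))).continuous.tendsto l).comp hl
  obtain ⟨ψ, hψ, hae⟩ := (tendstoInMeasure_of_tendsto_Lp h1).exists_seq_tendsto_ae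
  have h3 := Lp.eLpNorm_lim_le_liminf_eLpNorm (p := q)
    (fun n => Lp.aestronglyMeasurable (p (ψ n)).fst) _ hae
  have h4 : Tendsto (fun n => (C : ℝ≥0∞) * ‖(p (ψ n)).snd‖ₑ) atTop (𝓝 (C * ‖l.snd‖ₑ)) :=
    ENNReal.Tendsto.const_mul ((h2.comp hψ.tendsto_atTop).enorm) (Or.inr ENNReal.coe_ne_top)
  exact h3.trans ((liminf_le_liminf (Eventually.of_forall fun n => hp (ψ n))).trans_eq
    h4.liminf_eq)

theorem exists_eLpNorm_six_fn_le (hN1 : 1 ≤ N) (hN3 : N ≤ 3) (hΩb : Bornology.IsBounded Ω) :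
    ∃ C : ℝ≥0, ∀ u : H10 Ω, eLpNorm u.fn 6 (vol Ω) ≤ C * ‖gradL Ω u‖ₑ := by
  obtain ⟨C, hC⟩ := exists_eLpNorm_six_le hN1 hN3 hΩb
  refine ⟨C, H10.induction_closed (isClosed_eLpNorm_fst_le 6 C) fun p φ hφ h1 h2 => ?_⟩
  rw [eLpNorm_congr_ae h1, Lp.enorm_def, eLpNorm_congr_ae h2]
  exact hC φ hφ

/-- The Sobolev inequality on `H₀¹(Ω)` for exponents up to six. -/
theorem exists_eLpNorm_fn_le (hN1 : 1 ≤ N) (hN3 : N ≤ 3) (hΩb : Bornology.IsBounded Ω)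
    {q : ℝ≥0∞} (hq0 : q ≠ 0) (hq : q ≤ 6) :
    ∃ C : ℝ≥0, ∀ u : H10 Ω, eLpNorm u.fn q (vol Ω) ≤ C * ‖gradL Ω u‖ₑ := by
  obtain ⟨C, hC⟩ := exists_eLpNorm_six_fn_le hN1 hN3 hΩb
  have hfin : (vol Ω) Set.univ ≠ ⊤ := by
    rw [Measure.restrict_apply_univ]; exact hΩb.measure_lt_top.ne
  have hexp : 0 ≤ 1 / q.toReal - 1 / (6 : ℝ≥0∞).toReal := by
    have hq' : q ≠ ⊤ := ne_top_of_le_ne_top (by simp) hq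
    have h1 : 0 < q.toReal := ENNReal.toReal_pos hq0 hq'
    have h2 : q.toReal ≤ (6 : ℝ≥0∞).toReal := ENNReal.toReal_mono (by simp) hq
    exact sub_nonneg.2 (one_div_le_one_div_of_le h1 h2)
  refine ⟨C * ((vol Ω) Set.univ ^ (1 / q.toReal - 1 / (6 : ℝ≥0∞).toReal)).toNNReal, fun u => ?_⟩
  rw [ENNReal.coe_mul, ENNReal.coe_toNNReal (ENNReal.rpow_ne_top_of_nonneg hexp hfin),
    mul_right_comm]
  exact (eLpNorm_le_eLpNorm_mul_rpow_measure_univ hq (Lp.aestronglyMeasurable _)).trans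
    (mul_le_mul_left (hC u) _)

/-- The Poincaré inequality. -/
theorem exists_norm_fnL_le (hN1 : 1 ≤ N) (hN3 : N ≤ 3) (hΩb : Bornology.IsBounded Ω) :
    ∃ C : ℝ, 0 ≤ C ∧ ∀ u : H10 Ω, ‖fnL Ω u‖ ≤ C * ‖gradL Ω u‖ := by
  obtain ⟨C, hC⟩ := exists_eLpNorm_fn_le hN1 hN3 hΩb (q := 2) (by simp)
    (by exact_mod_cast (by norm_num : (2 : ℝ≥0) ≤ 6))
  refine ⟨C, C.2, fun u => ?_⟩
  have h := hC u
  rw [H10.fn_eq, ← Lp.enorm_def, enorm_eq_nnnorm, enorm_eq_nnnorm, ← ENNReal.coe_mul,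
    ENNReal.coe_le_coe] at h
  exact_mod_cast h

/-- The `L²` norm on `H₀¹(Ω)` is controlled by a small multiple of the norm of the gradient and by
finitely many bounded linear functionals on `L²(Ω)`. -/
theorem exists_finset_norm_fnL_sq_le (hΩo : IsOpen Ω) (hΩb : Bornology.IsBounded Ω)
    {η : ℝ} (hη : 0 < η) :
    ∃ (t : Finset (RN N)) (w : RN N → Lp ℝ 2 (vol Ω)) (C : ℝ), ∀ u : H10 Ω,
      ‖fnL Ω u‖ ^ 2 ≤ η * ‖gradL Ω u‖ ^ 2 + C * ∑ y ∈ t, inner ℝ (w y) (fnL Ω u) ^ 2 := by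
  -- This ε makes the gradient constant 2 · 2^N · (2ε)² of `IsTestFun.lintegral_sq_le` equal to η.
  set ε : ℝ := √(η / (8 * 2 ^ N)) with hε'
  have hε : 0 < ε := by positivity
  have hεη : 2 * (2 ^ N * (2 * ε) ^ 2) = η := by
    rw [mul_pow, hε', Real.sq_sqrt (by positivity)]; field_simp; norm_num
  obtain ⟨t, htf, ht⟩ := Metric.totallyBounded_iff.mp (hΩb.isCompact_closure.totallyBounded.subset subset_closure) ε hε
  have htop : ∀ y, vol Ω (Metric.ball y ε) ≠ ⊤ := fun y =>
    ((Measure.restrict_apply_le _ _).trans_lt measure_ball_lt_top).ne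
  set K : ℝ≥0∞ := 2 * (volume (Metric.ball (0 : RN N) ε))⁻¹ ^ 2 * volume Ω with hK
  have hKt : K ≠ ⊤ := by
    have : (volume (Metric.ball (0 : RN N) ε))⁻¹ ≠ ⊤ :=
      ENNReal.inv_ne_top.2 (Metric.measure_ball_pos _ _ hε).ne'
    exact ENNReal.mul_ne_top (ENNReal.mul_ne_top (by simp) (ENNReal.pow_ne_top this))
      hΩb.measure_lt_top.ne
  -- The functionals are the integrals over the covering balls, that is, pairings with their
  -- indicators.
  refine ⟨htf.toFinset, fun y => indicatorConstLp 2 measurableSet_ball (htop y) (1 : ℝ),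
    K.toReal, ?_⟩
  refine H10.induction_closed (P := fun p => ‖p.fst‖ ^ 2 ≤ η * ‖p.snd‖ ^ 2 + K.toReal *
    ∑ y ∈ htf.toFinset, inner ℝ (indicatorConstLp 2 measurableSet_ball (htop y) (1 : ℝ)) p.fst ^ 2)
    ?_ fun p φ hφ h1 h2 => ?_
  · have hf : Continuous fun p : L2Pair Ω => p.fst :=
      (WithLp.fstL 2 ℝ (Lp ℝ 2 (vol Ω)) (Lp (RN N) 2 (vol Ω))).continuous
    have hs : Continuous fun p : L2Pair Ω => p.snd :=
      (WithLp.sndL 2 ℝ (Lp ℝ 2 (vol Ω)) (Lp (RN N) 2 (vol Ω))).continuous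
    exact isClosed_le (by fun_prop) (by fun_prop)
  · have h := hφ.lintegral_sq_le hΩo hε (t := htf.toFinset) (by simpa using ht)
    have e1 : ∫⁻ x in Ω, ‖φ x‖ₑ ^ 2 = ENNReal.ofReal (‖p.fst‖ ^ 2) := by
      rw [← lintegral_sq_enorm_eq]
      exact lintegral_congr_ae (h1.mono fun x hx => by simp only [hx])
    have e2 : ∫⁻ x in Ω, ‖gradient φ x‖ₑ ^ 2 = ENNReal.ofReal (‖p.snd‖ ^ 2) := by
      rw [← lintegral_sq_enorm_eq]
      exact lintegral_congr_ae (h2.mono fun x hx => by simp only [hx])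
    rw [e1, e2, ← hK] at h
    have h3 : ∀ y, ‖∫ z in Metric.ball y ε, φ z ∂(vol Ω)‖ₑ ^ 2 = ENNReal.ofReal
        (inner ℝ (indicatorConstLp 2 measurableSet_ball (htop y) (1 : ℝ)) p.fst ^ 2) := by
      intro y
      rw [L2.inner_indicatorConstLp_one measurableSet_ball (htop y),
        integral_congr_ae (ae_restrict_of_ae h1), ← ofReal_norm,
        ← ENNReal.ofReal_pow (norm_nonneg _), Real.norm_eq_abs, sq_abs]
    simp_rw [h3] at h
    rw [← ENNReal.ofReal_sum_of_nonneg (fun _ _ => sq_nonneg _), ← ENNReal.ofReal_toReal hKt,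
      ← ENNReal.ofReal_mul ENNReal.toReal_nonneg] at h
    have e3 : 2 * (2 ^ N * (ENNReal.ofReal (2 * ε) ^ 2 * ENNReal.ofReal (‖p.snd‖ ^ 2))) =
        ENNReal.ofReal (2 * (2 ^ N * ((2 * ε) ^ 2 * ‖p.snd‖ ^ 2))) := by
      rw [ENNReal.ofReal_mul (q := 2 ^ N * _) zero_le_two, ENNReal.ofReal_mul (by positivity : (0 : ℝ) ≤ 2 ^ N),
        ENNReal.ofReal_mul (by positivity : 0 ≤ (2 * ε) ^ 2), ENNReal.ofReal_pow zero_le_two,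
        ENNReal.ofReal_pow (by positivity : 0 ≤ 2 * ε), ENNReal.ofReal_ofNat]
    have hnn : 0 ≤ K.toReal * ∑ y ∈ htf.toFinset,
        inner ℝ (indicatorConstLp 2 measurableSet_ball (htop y) (1 : ℝ)) p.fst ^ 2 :=
      mul_nonneg ENNReal.toReal_nonneg (Finset.sum_nonneg fun _ _ => sq_nonneg _)
    rw [e3, ← ENNReal.ofReal_add (by positivity) hnn,
      ENNReal.ofReal_le_ofReal_iff (add_nonneg (by positivity) hnn)] at h
    calc _ ≤ _ := h
      _ = _ := by rw [← hεη]; ring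

/-! ### Weak convergence and the Rellich theorem. -/

/-- Weak convergence of a sequence in a Hilbert space. -/
def WeakTendsto {H : Type*} [NormedAddCommGroup H] [InnerProductSpace ℝ H] (u : ℕ → H) (w : H) :
    Prop :=
  ∀ v, Tendsto (fun n => inner ℝ (u n) v) atTop (𝓝 (inner ℝ w v))

theorem WeakTendsto.map {H : Type*} [NormedAddCommGroup H] [InnerProductSpace ℝ H]
    [CompleteSpace H] {u : ℕ → H} {w : H} (h : WeakTendsto u w) (l : H →L[ℝ] ℝ) :
    Tendsto (fun n => l (u n)) atTop (𝓝 (l w)) := by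
  have h1 : ∀ x, inner ℝ x ((InnerProductSpace.toDual ℝ H).symm l) = l x := fun x => by
    rw [real_inner_comm, InnerProductSpace.toDual_symm_apply]
  simpa only [h1] using h ((InnerProductSpace.toDual ℝ H).symm l)

/-- The Rellich theorem: the inclusion of `H₀¹(Ω)` in `L²(Ω)` is completely continuous. -/
theorem tendsto_fnL_of_weakTendsto (hΩo : IsOpen Ω) (hΩb : Bornology.IsBounded Ω)
    {u : ℕ → H10 Ω} {w : H10 Ω} {R : ℝ} (hu : ∀ n, ‖u n‖ ≤ R) (hw : WeakTendsto u w) :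
    Tendsto (fun n => fnL Ω (u n)) atTop (𝓝 (fnL Ω w)) := by
  rw [tendsto_iff_norm_sub_tendsto_zero]
  simp_rw [← map_sub]
  have hR : ∀ n, ‖gradL Ω (u n - w)‖ ^ 2 ≤ (R + ‖w‖) ^ 2 := fun n => by
    have h1 := H10.norm_sq (u n - w)
    have h2 : ‖u n - w‖ ≤ R + ‖w‖ := (norm_sub_le _ _).trans (by linarith [hu n])
    have h3 : ‖u n - w‖ ^ 2 ≤ (R + ‖w‖) ^ 2 := by gcongr
    nlinarith [sq_nonneg ‖fnL Ω (u n - w)‖]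
  have hsq : Tendsto (fun n => ‖fnL Ω (u n - w)‖ ^ 2) atTop (𝓝 0) := by
    rw [Metric.tendsto_atTop']
    intro δ hδ
    -- With this η the gradient term stays below δ/2 for all n; the finitely many functionals tend
    -- to zero by weak convergence.
    set η : ℝ := δ / (2 * ((R + ‖w‖) ^ 2 + 1)) with hη'
    have hη : 0 < η := by positivity
    obtain ⟨t, e, C, hC⟩ := exists_finset_norm_fnL_sq_le hΩo hΩb hη
    have hlim : Tendsto (fun n => C * ∑ y ∈ t, inner ℝ (e y) (fnL Ω (u n - w)) ^ 2) atTop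
        (𝓝 0) := by
      have h0 : C * ∑ y ∈ t, (0 : ℝ) ^ 2 = 0 := by simp
      rw [← h0]
      refine (tendsto_finsetSum _ fun y _ => Tendsto.pow ?_ 2).const_mul C
      have := hw.map ((innerSL ℝ (e y)).comp (fnL Ω))
      simpa [map_sub, inner_sub_right] using this.sub_const (inner ℝ (e y) (fnL Ω w))
    obtain ⟨n0, hn0⟩ := eventually_atTop.mp (hlim.eventually (gt_mem_nhds (half_pos hδ)))
    refine ⟨n0, fun n hn => ?_⟩
    rw [Real.dist_eq, sub_zero, abs_of_nonneg (sq_nonneg _)]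
    have h1 := hC (u n - w)
    have h2 : η * ‖gradL Ω (u n - w)‖ ^ 2 ≤ δ / 2 := by
      calc _ ≤ η * ((R + ‖w‖) ^ 2 + 1) := by gcongr; linarith [hR n]
        _ = δ / 2 := by rw [hη']; field_simp
    linarith [hn0 n hn.le]
  have := hsq.sqrt
  simpa [Real.sqrt_sq] using this

/-! ### The quadratic form of -Δ + V. -/

/-- Multiplication by an essentially bounded function on `L²(Ω)`. -/
def mulL {f : RN N → ℝ} (hf : MemLp f ⊤ (vol Ω)) : Lp ℝ 2 (vol Ω) →L[ℝ] Lp ℝ 2 (vol Ω) :=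
  (ContinuousLinearMap.mul ℝ ℝ).holderL (vol Ω) ⊤ 2 2 hf.toLp

theorem coeFn_mulL {f : RN N → ℝ} (hf : MemLp f ⊤ (vol Ω)) (g : Lp ℝ 2 (vol Ω)) :
    mulL hf g =ᵐ[vol Ω] fun x => f x * g x := by
  filter_upwards [(ContinuousLinearMap.mul ℝ ℝ).coeFn_holder (r := 2) hf.toLp g,
    hf.coeFn_toLp] with x hx hx'
  rw [← hx']
  exact hx

theorem inner_mulL_eq_integral {f : RN N → ℝ} (hf : MemLp f ⊤ (vol Ω)) (g k : Lp ℝ 2 (vol Ω)) :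
    inner ℝ g (mulL hf k) = ∫ x, f x * k x * g x ∂(vol Ω) := by
  rw [L2.inner_def]
  refine integral_congr_ae ((coeFn_mulL hf k).mono fun x hx => ?_)
  simp [hx]

theorem integrable_mulL {f : RN N → ℝ} (hf : MemLp f ⊤ (vol Ω)) (g k : Lp ℝ 2 (vol Ω)) :
    Integrable (fun x => f x * k x * g x) (vol Ω) := by
  refine (L2.integrable_inner (𝕜 := ℝ) g (mulL hf k)).congr ((coeFn_mulL hf k).mono fun x hx => ?_)
  simp [hx]

theorem integrable_norm_sq_lp {E : Type*} [NormedAddCommGroup E] [InnerProductSpace ℝ E]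
    (f : Lp E 2 (vol Ω)) : Integrable (fun x => ‖f x‖ ^ 2) (vol Ω) := by
  simpa [real_inner_self_eq_norm_sq] using L2.integrable_inner (𝕜 := ℝ) f f

theorem integral_norm_sq_lp {E : Type*} [NormedAddCommGroup E] [InnerProductSpace ℝ E]
    (f : Lp E 2 (vol Ω)) : ∫ x, ‖f x‖ ^ 2 ∂(vol Ω) = ‖f‖ ^ 2 := by
  rw [← real_inner_self_eq_norm_sq, L2.inner_def]
  simp

theorem integrable_normSq {V : RN N → ℝ} (hV : MemLp V ⊤ (vol Ω)) (u : H10 Ω) :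
    Integrable (fun x => ‖u.grad x‖ ^ 2 + V x * u.fn x ^ 2) (vol Ω) := by
  refine (integrable_norm_sq_lp (gradL Ω u)).add ?_
  exact (integrable_mulL hV (fnL Ω u) (fnL Ω u)).congr
    (Eventually.of_forall fun x => by simp only [H10.fn_eq]; ring)

theorem normSq_eq {V : RN N → ℝ} (hV : MemLp V ⊤ (vol Ω)) (u : H10 Ω) :
    normSq V u = ‖gradL Ω u‖ ^ 2 + inner ℝ (fnL Ω u) (mulL hV (fnL Ω u)) := by
  rw [inner_mulL_eq_integral, ← integral_norm_sq_lp (gradL Ω u),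
    ← integral_add (integrable_norm_sq_lp (gradL Ω u)) (integrable_mulL hV _ _)]
  simp only [normSq, pow_two, mul_assoc]
  rfl

theorem normSq_smul {V : RN N → ℝ} (hV : MemLp V ⊤ (vol Ω)) (c : ℝ) (u : H10 Ω) :
    normSq V (c • u) = c ^ 2 * normSq V u := by
  simp only [normSq_eq hV, map_smul, norm_smul, real_inner_smul_left, real_inner_smul_right,
    mul_pow, Real.norm_eq_abs, sq_abs]
  ring

/-! ### The first Dirichlet eigenvalue and coercivity. -/

theorem isDirichletEigenvalue_iff {l : ℝ} : IsDirichletEigenvalue Ω l ↔ ∃ u : H10 Ω, u ≠ 0 ∧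
    ∀ v : H10 Ω, inner ℝ (gradL Ω u) (gradL Ω v) = l * inner ℝ (fnL Ω u) (fnL Ω v) := by
  have h1 : ∀ u v : H10 Ω, ∫ x, inner ℝ (u.grad x) (v.grad x) ∂(vol Ω) =
      inner ℝ (gradL Ω u) (gradL Ω v) := fun u v => (L2.inner_def _ _).symm
  have h2 : ∀ u v : H10 Ω, ∫ x, u.fn x * v.fn x ∂(vol Ω) = inner ℝ (fnL Ω u) (fnL Ω v) := by
    intro u v
    rw [L2.inner_def]
    refine integral_congr_ae (Eventually.of_forall fun x => ?_)
    change fnL Ω u x * fnL Ω v x = fnL Ω v x * fnL Ω u x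
    exact mul_comm _ _
  simp only [IsDirichletEigenvalue, h1, h2]

/-- Testing the equation with u itself excludes negative eigenvalues. The bound is needed because a
real `sInf` over a set unbounded below takes the default value 0. -/
theorem bddBelow_dirichletEigenvalue : BddBelow {l : ℝ | IsDirichletEigenvalue Ω l} := by
  refine ⟨0, fun l hl => ?_⟩
  obtain ⟨u, hu, h⟩ := isDirichletEigenvalue_iff.mp hl
  have h1 := h u
  rw [real_inner_self_eq_norm_sq, real_inner_self_eq_norm_sq] at h1
  by_contra! hneg
  have h2 := H10.norm_sq u
  have h3 : 0 < ‖u‖ ^ 2 := by have := norm_pos_iff.mpr hu; positivity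
  have h4 : 0 ≤ ‖gradL Ω u‖ ^ 2 := sq_nonneg _
  have h5 : ‖fnL Ω u‖ ^ 2 = 0 := by nlinarith [sq_nonneg ‖fnL Ω u‖]
  rw [h5] at h1 h2
  linarith

/-- The minorant is 2⟨∇w, ∇u_n⟩ - ‖∇w‖². Stating lower semicontinuity through a convergent minorant
lets it be summed over components without any liminf. -/
theorem WeakTendsto.exists_le_norm_gradL_sq {u : ℕ → H10 Ω} {w : H10 Ω} (hw : WeakTendsto u w) :
    ∃ y : ℕ → ℝ, (∀ n, y n ≤ ‖gradL Ω (u n)‖ ^ 2) ∧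
      Tendsto y atTop (𝓝 (‖gradL Ω w‖ ^ 2)) := by
  have h1 := hw.map ((innerSL ℝ (gradL Ω w)).comp (gradL Ω))
  simp only [ContinuousLinearMap.comp_apply, innerSL_apply_apply, real_inner_self_eq_norm_sq] at h1
  have h2 := (h1.const_mul 2).sub_const (‖gradL Ω w‖ ^ 2)
  refine ⟨_, fun n => ?_, by convert h2 using 2; ring⟩
  have := norm_sub_sq_real (gradL Ω w) (gradL Ω (u n))
  nlinarith [sq_nonneg ‖gradL Ω w - gradL Ω (u n)‖]

theorem eq_zero_of_forall_quadratic_nonneg {b q : ℝ} (h : ∀ t : ℝ, 0 ≤ 2 * t * b + t ^ 2 * q) :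
    b = 0 := by
  have h1 := h (-b / (|q| + 1))
  have hq : 0 < |q| + 1 := by positivity
  have h2 : 2 * (-b / (|q| + 1)) * b + (-b / (|q| + 1)) ^ 2 * q =
      (b ^ 2 * (q - 2 * (|q| + 1))) / (|q| + 1) ^ 2 := by field_simp; ring
  rw [h2] at h1
  by_contra hb
  have hb2 : 0 < b ^ 2 := by positivity
  have h3 : b ^ 2 * (q - 2 * (|q| + 1)) < 0 :=
    mul_neg_of_pos_of_neg hb2 (by linarith [le_abs_self q, abs_nonneg q])
  exact absurd h1 (div_neg_of_neg_of_pos h3 (by positivity)).not_ge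

theorem norm_sq_map_add_smul {H G : Type*} [NormedAddCommGroup H] [NormedSpace ℝ H]
    [NormedAddCommGroup G] [InnerProductSpace ℝ G] (T : H →L[ℝ] G) (w z : H) (t : ℝ) :
    ‖T (w + t • z)‖ ^ 2 = ‖T w‖ ^ 2 + 2 * (t * inner ℝ (T w) (T z)) + t ^ 2 * ‖T z‖ ^ 2 := by
  rw [map_add, map_smul, norm_add_sq_real, norm_smul, real_inner_smul_right, mul_pow,
    Real.norm_eq_abs, sq_abs]

/-- The variational characterization of the first Dirichlet eigenvalue. -/
theorem firstEigenvalue_mul_le (hΩo : IsOpen Ω) (hΩb : Bornology.IsBounded Ω) (u : H10 Ω) :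
    firstEigenvalue Ω * ‖fnL Ω u‖ ^ 2 ≤ ‖gradL Ω u‖ ^ 2 := by
  rcases eq_or_ne (fnL Ω u) 0 with hu0 | hu0
  · simp [hu0]
  set S : Set ℝ := {r | ∃ v : H10 Ω, ‖fnL Ω v‖ = 1 ∧ ‖gradL Ω v‖ ^ 2 = r} with hS
  have hbdd : BddBelow S := ⟨0, by rintro r ⟨v, -, rfl⟩; positivity⟩
  have hmem : ∀ v : H10 Ω, fnL Ω v ≠ 0 → ‖gradL Ω v‖ ^ 2 / ‖fnL Ω v‖ ^ 2 ∈ S := by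
    intro v hv
    have hv' : ‖fnL Ω v‖ ≠ 0 := norm_ne_zero_iff.mpr hv
    refine ⟨‖fnL Ω v‖⁻¹ • v, ?_, ?_⟩
    · rw [map_smul, norm_smul, norm_inv, norm_norm, inv_mul_cancel₀ hv']
    · rw [map_smul, norm_smul, norm_inv, norm_norm, mul_pow, inv_pow]; field_simp
  have hne : S.Nonempty := ⟨_, hmem u hu0⟩
  have hlow : ∀ v : H10 Ω, sInf S * ‖fnL Ω v‖ ^ 2 ≤ ‖gradL Ω v‖ ^ 2 := by
    intro v
    rcases eq_or_ne (fnL Ω v) 0 with hv | hv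
    · simp [hv]
    · have hv' : 0 < ‖fnL Ω v‖ := norm_pos_iff.mpr hv
      exact (le_div_iff₀ (by positivity)).mp (csInf_le hbdd (hmem v hv))
  -- Direct method: a normalized minimizing sequence for the Rayleigh quotient converges weakly, and
  -- Rellich preserves the constraint ‖w‖ = 1 in L².
  obtain ⟨x, -, hxlim, hxS⟩ := exists_seq_tendsto_sInf hne hbdd
  choose v hv1 hv2 using hxS
  obtain ⟨M, hM⟩ := hxlim.bddAbove_range
  have hbound : ∀ n, ‖v n‖ ≤ √(1 + M) := fun n => by
    refine Real.le_sqrt_of_sq_le ?_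
    rw [H10.norm_sq, hv1, hv2, one_pow]
    linarith [hM ⟨n, rfl⟩]
  obtain ⟨w, ψ, hψ, hw⟩ := exists_subseq_tendsto_inner v _ hbound
  have hw : WeakTendsto (fun n => v (ψ n)) w := hw
  have hw1 : ‖fnL Ω w‖ = 1 := by
    have := (tendsto_fnL_of_weakTendsto hΩo hΩb (fun n => hbound (ψ n)) hw).norm
    simp only [hv1] at this
    exact tendsto_nhds_unique this tendsto_const_nhds
  have hw2 : ‖gradL Ω w‖ ^ 2 ≤ sInf S :=
    let ⟨_, hy, hyl⟩ := hw.exists_le_norm_gradL_sq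
    le_of_tendsto_of_tendsto' hyl (hxlim.comp hψ.tendsto_atTop)
      fun n => (hy n).trans (hv2 (ψ n)).le
  have heig : IsDirichletEigenvalue Ω (sInf S) := by
    refine isDirichletEigenvalue_iff.mpr ⟨w, ?_, fun z => sub_eq_zero.mp ?_⟩
    · rintro rfl
      simp at hw1
    -- First variation: the Rayleigh inequality at w + t z is a quadratic in t whose constant term
    -- is nonpositive by `hw2`, so its linear coefficient vanishes; that is the eigenvalue equation
    -- tested with z.
    · refine eq_zero_of_forall_quadratic_nonneg
        (q := ‖gradL Ω z‖ ^ 2 - sInf S * ‖fnL Ω z‖ ^ 2) fun t => ?_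
      have h1 := hlow (w + t • z)
      rw [norm_sq_map_add_smul, norm_sq_map_add_smul, hw1, one_pow] at h1
      linarith
  -- The minimum of the Rayleigh quotient is itself an eigenvalue, so the infimum of the eigenvalues
  -- cannot exceed it.
  have hle : firstEigenvalue Ω ≤ sInf S := csInf_le bddBelow_dirichletEigenvalue heig
  exact (mul_le_mul_of_nonneg_right hle (sq_nonneg _)).trans (hlow u)

/-- Coercivity of the quadratic form of `-Δ + V`. -/
theorem exists_coercive (hN1 : 1 ≤ N) (hN3 : N ≤ 3) (hΩo : IsOpen Ω)
    (hΩb : Bornology.IsBounded Ω) {V : RN N → ℝ} (hV : MemLp V ⊤ (vol Ω))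
    (hl : ∃ l : ℝ, -firstEigenvalue Ω < l ∧ ∀ᵐ x ∂(vol Ω), l ≤ V x) :
    ∃ c : ℝ, 0 < c ∧ ∀ u : H10 Ω, c * ‖u‖ ^ 2 ≤ normSq V u := by
  obtain ⟨l, hl, hlV⟩ := hl
  obtain ⟨C, hC0, hC⟩ := exists_norm_fnL_le hN1 hN3 hΩb
  set e := firstEigenvalue Ω
  -- Chosen so that 0 < δ ≤ 1 and (1 - δ) e + l ≥ 0: a fraction 1 - δ of the gradient term absorbs
  -- the potential and δ is left over. Taking |e| avoids any discussion of the sign of e.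
  set δ := (e + l) / (|e| + (e + l)) with hδ
  have hpos : 0 < e + l := by linarith
  have hδ0 : 0 < δ := by positivity
  have hδ1 : δ ≤ 1 := by rw [hδ, div_le_one (by positivity)]; linarith [abs_nonneg e]
  have hδe : δ * e ≤ e + l := by
    rw [hδ, div_mul_eq_mul_div, div_le_iff₀ (by positivity)]
    have : e ≤ |e| + (e + l) := by linarith [le_abs_self e]
    nlinarith
  refine ⟨δ / (C ^ 2 + 1), by positivity, fun u => ?_⟩
  have h1 : ‖gradL Ω u‖ ^ 2 + l * ‖fnL Ω u‖ ^ 2 ≤ normSq V u := by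
    rw [normSq_eq hV, inner_mulL_eq_integral, ← integral_norm_sq_lp (fnL Ω u),
      ← integral_const_mul]
    refine add_le_add le_rfl (integral_mono_ae ((integrable_norm_sq_lp (fnL Ω u)).const_mul l)
      (integrable_mulL hV _ _) (hlV.mono fun x hx => ?_))
    have : l * ‖fnL Ω u x‖ ^ 2 ≤ V x * ‖fnL Ω u x‖ ^ 2 := by gcongr
    calc l * ‖fnL Ω u x‖ ^ 2 ≤ V x * ‖fnL Ω u x‖ ^ 2 := this
      _ = V x * fnL Ω u x * fnL Ω u x := by rw [Real.norm_eq_abs, sq_abs]; ring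
  have h2 := firstEigenvalue_mul_le hΩo hΩb u
  have h3 : δ * ‖gradL Ω u‖ ^ 2 ≤ ‖gradL Ω u‖ ^ 2 + l * ‖fnL Ω u‖ ^ 2 := by
    have h4 := mul_le_mul_of_nonneg_left h2 (sub_nonneg.mpr hδ1)
    have h5 := mul_le_mul_of_nonneg_right hδe (sq_nonneg ‖fnL Ω u‖)
    nlinarith
  have h6 : ‖u‖ ^ 2 ≤ (C ^ 2 + 1) * ‖gradL Ω u‖ ^ 2 := by
    have : ‖fnL Ω u‖ ^ 2 ≤ (C * ‖gradL Ω u‖) ^ 2 := by gcongr; exact hC u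
    rw [H10.norm_sq]
    nlinarith
  calc δ / (C ^ 2 + 1) * ‖u‖ ^ 2 ≤ δ / (C ^ 2 + 1) * ((C ^ 2 + 1) * ‖gradL Ω u‖ ^ 2) := by gcongr
    _ = δ * ‖gradL Ω u‖ ^ 2 := by field_simp
    _ ≤ normSq V u := h3.trans h1

/-! ### Quartic integrals: bounds and weak continuity. -/

/-- Cauchy-Schwarz for |f|⁴ = |f| · |f|³. It transfers L² convergence to L⁴ under an L⁶ bound. -/
theorem eLpNorm_four_pow_le {α : Type*} [MeasurableSpace α] {μ : Measure α} {f : α → ℝ}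
    (hf : AEStronglyMeasurable f μ) :
    eLpNorm f 4 μ ^ 4 ≤ eLpNorm f 2 μ * eLpNorm f 6 μ ^ 3 := by
  have hp : ∀ p : ℕ, p ≠ 0 → eLpNorm f p μ ^ p = ∫⁻ x, ‖f x‖ₑ ^ p ∂μ := fun p hp => by
    have := eLpNorm_nnreal_pow_eq_lintegral (μ := μ) (f := f) (p := (p : ℝ≥0))
      (by exact_mod_cast hp)
    simpa using this
  have h2 := hp 2 two_ne_zero
  have h4 := hp 4 four_ne_zero
  have h6 := hp 6 (by norm_num)
  have hholder := ENNReal.lintegral_mul_le_Lp_mul_Lq μ Real.HolderConjugate.two_two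
    hf.enorm (hf.enorm.pow_const 3)
  simp only [Pi.mul_apply] at hholder
  push_cast at h2 h4 h6
  rw [h4]
  calc ∫⁻ x, ‖f x‖ₑ ^ 4 ∂μ = ∫⁻ x, ‖f x‖ₑ * ‖f x‖ₑ ^ 3 ∂μ := by
        congr 1; funext x; ring
    _ ≤ _ := hholder
    _ = (eLpNorm f 2 μ ^ 2) ^ (1 / 2 : ℝ) * (eLpNorm f 6 μ ^ 6) ^ (1 / 2 : ℝ) := by
        rw [h2, h6]
        congr 3
        · funext x; norm_cast
        · funext x
          rw [show (2 : ℝ) = ((2 : ℕ) : ℝ) by norm_num, ENNReal.rpow_natCast, ← pow_mul]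
    _ = _ := by
        congr 1 <;> rw [← ENNReal.rpow_natCast, ← ENNReal.rpow_mul]
        · norm_num
        · rw [← ENNReal.rpow_natCast]; norm_num

theorem memLp_fn (hN1 : 1 ≤ N) (hN3 : N ≤ 3) (hΩb : Bornology.IsBounded Ω)
    {q : ℝ≥0∞} (hq0 : q ≠ 0) (hq : q ≤ 6) (u : H10 Ω) : MemLp u.fn q (vol Ω) := by
  obtain ⟨C, hC⟩ := exists_eLpNorm_fn_le hN1 hN3 hΩb hq0 hq
  exact ⟨Lp.aestronglyMeasurable _, (hC u).trans_lt
    (ENNReal.mul_lt_top ENNReal.coe_lt_top enorm_lt_top)⟩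

theorem four_le_six : (4 : ℝ≥0∞) ≤ 6 := by exact_mod_cast (by norm_num : (4 : ℝ≥0) ≤ 6)

instance holderTriple_four_four_two : ENNReal.HolderTriple 4 4 2 where
  inv_add_inv_eq_inv := by
    have h : (4 : ℝ≥0∞) = 2 * 2 := by norm_num
    rw [h, ENNReal.mul_inv (by simp) (by simp), ← mul_add, ENNReal.inv_two_add_inv_two, mul_one]

theorem memLp_fn_sq (hN1 : 1 ≤ N) (hN3 : N ≤ 3) (hΩb : Bornology.IsBounded Ω) (u : H10 Ω) :
    MemLp (fun x => u.fn x ^ 2) 2 (vol Ω) := by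
  have h := memLp_fn hN1 hN3 hΩb four_ne_zero four_le_six u
  simpa only [pow_two] using! h.smul (r := 2) h

/-- The square of an element of `H₀¹(Ω)`, as an element of `L²(Ω)`. -/
def sqL2 (hN1 : 1 ≤ N) (hN3 : N ≤ 3) (hΩb : Bornology.IsBounded Ω) (u : H10 Ω) :
    Lp ℝ 2 (vol Ω) := (memLp_fn_sq hN1 hN3 hΩb u).toLp

theorem coeFn_sqL2 (hN1 : 1 ≤ N) (hN3 : N ≤ 3) (hΩb : Bornology.IsBounded Ω)
    (u : H10 Ω) : sqL2 hN1 hN3 hΩb u =ᵐ[vol Ω] fun x => u.fn x ^ 2 :=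
  (memLp_fn_sq hN1 hN3 hΩb u).coeFn_toLp

theorem integral_quartic_eq (hN1 : 1 ≤ N) (hN3 : N ≤ 3) (hΩb : Bornology.IsBounded Ω)
    {b : RN N → ℝ} (hb : MemLp b ⊤ (vol Ω)) (u v : H10 Ω) :
    ∫ x, b x * u.fn x ^ 2 * v.fn x ^ 2 ∂(vol Ω) =
      inner ℝ (sqL2 hN1 hN3 hΩb v) (mulL hb (sqL2 hN1 hN3 hΩb u)) := by
  rw [inner_mulL_eq_integral]
  refine integral_congr_ae ?_
  filter_upwards [coeFn_sqL2 hN1 hN3 hΩb u, coeFn_sqL2 hN1 hN3 hΩb v] with x h1 h2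
  rw [h1, h2]

theorem integrable_quartic (hN1 : 1 ≤ N) (hN3 : N ≤ 3) (hΩb : Bornology.IsBounded Ω)
    {b : RN N → ℝ} (hb : MemLp b ⊤ (vol Ω)) (u v : H10 Ω) :
    Integrable (fun x => b x * u.fn x ^ 2 * v.fn x ^ 2) (vol Ω) := by
  refine (integrable_mulL hb (sqL2 hN1 hN3 hΩb v) (sqL2 hN1 hN3 hΩb u)).congr ?_
  filter_upwards [coeFn_sqL2 hN1 hN3 hΩb u, coeFn_sqL2 hN1 hN3 hΩb v] with x h1 h2
  rw [h1, h2]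

theorem fn_smul (c : ℝ) (u : H10 Ω) : (c • u).fn =ᵐ[vol Ω] fun x => c * u.fn x := by
  have : fnL Ω (c • u) = c • fnL Ω u := map_smul _ _ _
  rw [H10.fn_eq, this]
  exact Lp.coeFn_smul c (fnL Ω u)

theorem integral_quartic_smul (b : RN N → ℝ) (s t : ℝ) (u v : H10 Ω) :
    ∫ x, b x * (s • u).fn x ^ 2 * (t • v).fn x ^ 2 ∂(vol Ω) =
      s ^ 2 * t ^ 2 * ∫ x, b x * u.fn x ^ 2 * v.fn x ^ 2 ∂(vol Ω) := by
  rw [← integral_const_mul]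
  refine integral_congr_ae ?_
  filter_upwards [fn_smul s u, fn_smul t v] with x h1 h2
  rw [h1, h2]
  ring

/-- Hölder with exponents 4, 4, 2 applied to u² - v² = (u - v)(u + v). -/
theorem norm_sqL2_sub_le (hN1 : 1 ≤ N) (hN3 : N ≤ 3) (hΩb : Bornology.IsBounded Ω)
    (u v : H10 Ω) : ‖sqL2 hN1 hN3 hΩb u - sqL2 hN1 hN3 hΩb v‖ ≤
    (eLpNorm (u - v).fn 4 (vol Ω)).toReal * (eLpNorm (u + v).fn 4 (vol Ω)).toReal := by
  have hm := memLp_fn hN1 hN3 hΩb four_ne_zero four_le_six (u - v)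
  have hp := memLp_fn hN1 hN3 hΩb four_ne_zero four_le_six (u + v)
  rw [← ENNReal.toReal_mul, Lp.norm_def]
  refine ENNReal.toReal_mono (ENNReal.mul_ne_top hm.2.ne hp.2.ne) ?_
  refine le_trans (le_of_eq (eLpNorm_congr_ae ?_))
    (eLpNorm_smul_le_mul_eLpNorm (r := 2) hp.1 hm.1)
  have e1 : fnL Ω (u - v) = fnL Ω u - fnL Ω v := map_sub _ _ _
  have e2 : fnL Ω (u + v) = fnL Ω u + fnL Ω v := map_add _ _ _
  rw [H10.fn_eq, H10.fn_eq, e1, e2]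
  filter_upwards [Lp.coeFn_sub (sqL2 hN1 hN3 hΩb u) (sqL2 hN1 hN3 hΩb v),
    coeFn_sqL2 hN1 hN3 hΩb u, coeFn_sqL2 hN1 hN3 hΩb v, Lp.coeFn_sub (fnL Ω u) (fnL Ω v),
    Lp.coeFn_add (fnL Ω u) (fnL Ω v)] with x h1 h2 h3 h4 h5
  rw [h1, Pi.smul_apply', h4, h5, Pi.sub_apply, Pi.sub_apply, Pi.add_apply, h2, h3, smul_eq_mul,
    H10.fn_eq, H10.fn_eq]
  ring

theorem norm_gradL_le (u : H10 Ω) : ‖gradL Ω u‖ ≤ ‖u‖ := by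
  have := H10.norm_sq u
  exact (abs_le_of_sq_le_sq' (by nlinarith [sq_nonneg ‖fnL Ω u‖]) (norm_nonneg _)).2

theorem exists_toReal_eLpNorm_fn_le (hN1 : 1 ≤ N) (hN3 : N ≤ 3) (hΩb : Bornology.IsBounded Ω)
    {q : ℝ≥0∞} (hq0 : q ≠ 0) (hq : q ≤ 6) :
    ∃ C : ℝ, 0 ≤ C ∧ ∀ u : H10 Ω, (eLpNorm u.fn q (vol Ω)).toReal ≤ C * ‖u‖ := by
  obtain ⟨C, hC⟩ := exists_eLpNorm_fn_le hN1 hN3 hΩb hq0 hq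
  refine ⟨C, C.2, fun u => ?_⟩
  have h := ENNReal.toReal_mono (ENNReal.mul_ne_top ENNReal.coe_ne_top enorm_ne_top) (hC u)
  rw [ENNReal.toReal_mul, toReal_enorm, ENNReal.coe_toReal] at h
  exact h.trans (mul_le_mul_of_nonneg_left (norm_gradL_le u) C.2)

theorem exists_norm_sqL2_le (hN1 : 1 ≤ N) (hN3 : N ≤ 3) (hΩb : Bornology.IsBounded Ω) :
    ∃ C : ℝ, 0 ≤ C ∧ ∀ u : H10 Ω, ‖sqL2 hN1 hN3 hΩb u‖ ≤ C * ‖u‖ ^ 2 := by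
  obtain ⟨C, hC0, hC⟩ := exists_toReal_eLpNorm_fn_le hN1 hN3 hΩb four_ne_zero four_le_six
  refine ⟨C ^ 2, sq_nonneg _, fun u => ?_⟩
  have h0 : sqL2 hN1 hN3 hΩb (0 : H10 Ω) = 0 := by
    rw [Lp.eq_zero_iff_ae_eq_zero]
    have e : fnL Ω (0 : H10 Ω) = 0 := map_zero _
    filter_upwards [coeFn_sqL2 hN1 hN3 hΩb (0 : H10 Ω), Lp.coeFn_zero ℝ 2 (vol Ω)] with x h1 h2
    rw [h1, H10.fn_eq, e, h2]
    simp
  have h := norm_sqL2_sub_le hN1 hN3 hΩb u 0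
  rw [h0, sub_zero, sub_zero, add_zero] at h
  calc _ ≤ _ := h
    _ ≤ (C * ‖u‖) * (C * ‖u‖) := by gcongr <;> exact hC u
    _ = C ^ 2 * ‖u‖ ^ 2 := by ring

theorem exists_abs_integral_quartic_le (hN1 : 1 ≤ N) (hN3 : N ≤ 3) (hΩb : Bornology.IsBounded Ω)
    {b : RN N → ℝ} (hb : MemLp b ⊤ (vol Ω)) :
    ∃ C : ℝ, 0 ≤ C ∧ ∀ u v : H10 Ω,
      |∫ x, b x * u.fn x ^ 2 * v.fn x ^ 2 ∂(vol Ω)| ≤ C * (‖u‖ ^ 2 * ‖v‖ ^ 2) := by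
  obtain ⟨C, hC0, hC⟩ := exists_norm_sqL2_le hN1 hN3 hΩb
  refine ⟨C ^ 2 * ‖mulL hb‖, by positivity, fun u v => ?_⟩
  rw [integral_quartic_eq hN1 hN3 hΩb hb]
  calc _ ≤ ‖sqL2 hN1 hN3 hΩb v‖ * ‖mulL hb (sqL2 hN1 hN3 hΩb u)‖ := abs_real_inner_le_norm _ _
    _ ≤ (C * ‖v‖ ^ 2) * (‖mulL hb‖ * (C * ‖u‖ ^ 2)) := by
        gcongr
        · exact hC v
        · exact ((mulL hb).le_opNorm _).trans (by gcongr; exact hC u)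
    _ = _ := by ring

/-- By interpolation u_n → w in L⁴: the L² norm of the difference vanishes by Rellich and its L⁶
norm stays bounded. The squares then converge in L², and every quartic integral passes to the limit.
-/
theorem tendsto_sqL2 (hN1 : 1 ≤ N) (hN3 : N ≤ 3) (hΩb : Bornology.IsBounded Ω)
    (hΩo : IsOpen Ω) {u : ℕ → H10 Ω} {w : H10 Ω} {R : ℝ}
    (hu : ∀ n, ‖u n‖ ≤ R) (hw : WeakTendsto u w) :
    Tendsto (fun n => sqL2 hN1 hN3 hΩb (u n)) atTop (𝓝 (sqL2 hN1 hN3 hΩb w)) := by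
  obtain ⟨C, hC0, hC⟩ := exists_toReal_eLpNorm_fn_le hN1 hN3 hΩb four_ne_zero four_le_six
  obtain ⟨D, hD0, hD⟩ := exists_toReal_eLpNorm_fn_le hN1 hN3 hΩb (q := 6) (by simp) le_rfl
  have hR0 : 0 ≤ R := (norm_nonneg _).trans (hu 0)
  set n4 : H10 Ω → ℝ := fun v => (eLpNorm v.fn 4 (vol Ω)).toReal with hn4
  have hfn : ∀ v : H10 Ω, n4 v ^ 4 ≤ ‖fnL Ω v‖ * (D * ‖v‖) ^ 3 := by
    intro v
    have h2 := Lp.memLp (fnL Ω v)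
    have h6 := memLp_fn hN1 hN3 hΩb (q := 6) (by simp) le_rfl v
    have h := ENNReal.toReal_mono (ENNReal.mul_ne_top h2.2.ne (ENNReal.pow_ne_top h6.2.ne))
      (eLpNorm_four_pow_le h2.1)
    rw [ENNReal.toReal_pow, ENNReal.toReal_mul, ENNReal.toReal_pow, ← Lp.norm_def] at h
    refine h.trans ?_
    gcongr
    exact hD v
  have h0 : Tendsto (fun n => n4 (u n - w)) atTop (𝓝 0) := by
    have h1 : Tendsto (fun n => ‖fnL Ω (u n - w)‖ * (D * (R + ‖w‖)) ^ 3) atTop (𝓝 0) := by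
      have h := tendsto_iff_norm_sub_tendsto_zero.mp (tendsto_fnL_of_weakTendsto hΩo hΩb hu hw)
      simp_rw [← map_sub] at h
      simpa using h.mul_const ((D * (R + ‖w‖)) ^ 3)
    have h2 : Tendsto (fun n => n4 (u n - w) ^ 4) atTop (𝓝 0) := by
      refine squeeze_zero (fun n => by positivity) (fun n => (hfn _).trans ?_) h1
      gcongr
      exact (norm_sub_le _ _).trans (by linarith [hu n])
    have h3 := h2.sqrt.sqrt
    have h4 : ∀ n, √√(n4 (u n - w) ^ 4) = n4 (u n - w) := fun n => by
      rw [show n4 (u n - w) ^ 4 = (n4 (u n - w) ^ 2) ^ 2 by ring, Real.sqrt_sq (sq_nonneg _),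
        Real.sqrt_sq ENNReal.toReal_nonneg]
    simpa only [h4, Real.sqrt_zero] using h3
  have h5 := h0.mul_const (C * (R + ‖w‖))
  rw [zero_mul] at h5
  rw [tendsto_iff_norm_sub_tendsto_zero]
  refine squeeze_zero (fun _ => norm_nonneg _) (fun n => ?_) h5
  refine (norm_sqL2_sub_le hN1 hN3 hΩb (u n) w).trans ?_
  refine mul_le_mul_of_nonneg_left ((hC _).trans ?_) ENNReal.toReal_nonneg
  gcongr
  exact (norm_add_le _ _).trans (by linarith [hu n])

theorem tendsto_integral_quartic (hN1 : 1 ≤ N) (hN3 : N ≤ 3) (hΩb : Bornology.IsBounded Ω)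
    (hΩo : IsOpen Ω) {b : RN N → ℝ} (hb : MemLp b ⊤ (vol Ω))
    {u v : ℕ → H10 Ω} {w z : H10 Ω} {R : ℝ} (hu : ∀ n, ‖u n‖ ≤ R) (hw : WeakTendsto u w)
    (hv : ∀ n, ‖v n‖ ≤ R) (hz : WeakTendsto v z) :
    Tendsto (fun n => ∫ x, b x * (u n).fn x ^ 2 * (v n).fn x ^ 2 ∂(vol Ω)) atTop
      (𝓝 (∫ x, b x * w.fn x ^ 2 * z.fn x ^ 2 ∂(vol Ω))) := by
  simp_rw [integral_quartic_eq hN1 hN3 hΩb hb]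
  exact (tendsto_sqL2 hN1 hN3 hΩb hΩo hv hz).inner
    (((mulL hb).continuous.tendsto _).comp (tendsto_sqL2 hN1 hN3 hΩb hΩo hu hw))

/-- Weak lower semicontinuity of `normSq V`, in a form which is stable under finite sums. -/
theorem WeakTendsto.exists_le_normSq (hΩo : IsOpen Ω) (hΩb : Bornology.IsBounded Ω)
    {V : RN N → ℝ} (hV : MemLp V ⊤ (vol Ω)) {u : ℕ → H10 Ω} {w : H10 Ω} {R : ℝ}
    (hu : ∀ n, ‖u n‖ ≤ R) (hw : WeakTendsto u w) :
    ∃ y : ℕ → ℝ, (∀ n, y n ≤ normSq V (u n)) ∧ Tendsto y atTop (𝓝 (normSq V w)) := by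
  have hf := tendsto_fnL_of_weakTendsto hΩo hΩb hu hw
  have hVt : Tendsto (fun n => inner ℝ (fnL Ω (u n)) (mulL hV (fnL Ω (u n)))) atTop
      (𝓝 (inner ℝ (fnL Ω w) (mulL hV (fnL Ω w)))) :=
    hf.inner (((mulL hV).continuous.tendsto _).comp hf)
  obtain ⟨y, hy, hyl⟩ := hw.exists_le_norm_gradL_sq
  refine ⟨fun n => y n + inner ℝ (fnL Ω (u n)) (mulL hV (fnL Ω (u n))), fun n => ?_, ?_⟩
  · rw [normSq_eq hV]
    linarith [hy n]
  · rw [normSq_eq hV]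
    exact hyl.add hVt

/-! ### The groups partition the indices. -/

section Groups

variable {a : Fin (m + 1) → ℕ}

theorem mem_group {h : Fin m} {i : Fin d} :
    i ∈ group a h ↔ a h.castSucc ≤ (i : ℕ) ∧ (i : ℕ) < a h.succ := by
  simp [group]

theorem exists_mem_group (ha : IsDecomposition m d a) (i : Fin d) :
    ∃ h : Fin m, i ∈ group a h := by
  have key : ∀ k : Fin (m + 1), (i : ℕ) < a k → ∃ h : Fin m, i ∈ group a h := by
    intro k
    induction k using Fin.induction with
    | zero => intro h; rw [ha.first] at h; omega
    | succ k ih =>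
      intro h
      by_cases hk : (i : ℕ) < a k.castSucc
      · exact ih hk
      · exact ⟨k, mem_group.mpr ⟨not_lt.mp hk, h⟩⟩
  exact key (Fin.last m) (by rw [ha.last]; exact i.2)

theorem eq_of_mem_group (ha : IsDecomposition m d a) {i : Fin d} {h k : Fin m}
    (hh : i ∈ group a h) (hk : i ∈ group a k) : h = k := by
  rw [mem_group] at hh hk
  have key : ∀ p q : Fin m, a p.castSucc ≤ (i : ℕ) → (i : ℕ) < a q.succ → p ≤ q := by
    intro p q hp hq
    by_contra! hlt
    have : a q.succ ≤ a p.castSucc := ha.strictMono.monotone (Fin.succ_le_castSucc_iff.mpr hlt)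
    omega
  exact le_antisymm (key _ _ hh.1 hk.2) (key _ _ hk.1 hh.2)

/-- The group which contains a given index. -/
def groupOf (ha : IsDecomposition m d a) (i : Fin d) : Fin m := (exists_mem_group ha i).choose

theorem mem_group_iff (ha : IsDecomposition m d a) {i : Fin d} {h : Fin m} :
    i ∈ group a h ↔ groupOf ha i = h :=
  have hi := (exists_mem_group ha i).choose_spec
  ⟨fun hh => eq_of_mem_group ha hi hh, fun e => e ▸ hi⟩

theorem sum_group (ha : IsDecomposition m d a) (f : Fin d → ℝ) :
    ∑ h, ∑ i ∈ group a h, f i = ∑ i, f i := by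
  have : ∀ h, group a h = Finset.univ.filter fun i => groupOf ha i = h := fun h => by
    ext i
    simp [mem_group_iff ha]
  simp_rw [this]
  exact Finset.sum_fiberwise _ _ _

theorem group_nonempty (ha : IsDecomposition m d a) (h : Fin m) :
    (group a h : Finset (Fin d)).Nonempty := by
  have h1 : a h.castSucc < a h.succ := ha.strictMono Fin.castSucc_lt_succ
  have h2 : a h.succ ≤ d := by
    rw [← ha.last]; exact ha.strictMono.monotone (Fin.le_last _)
  exact ⟨⟨a h.castSucc, by omega⟩, mem_group.mpr ⟨le_rfl, h1⟩⟩

end Groups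

/-! ### Energy, Nehari constraints and scaling by groups. -/

/-- `∫_Ω b u² v²`. -/
def quartic (b : RN N → ℝ) (u v : H10 Ω) : ℝ :=
  ∫ x, b x * u.fn x ^ 2 * v.fn x ^ 2 ∂(vol Ω)

theorem couplingMatrix_apply (a : Fin (m + 1) → ℕ) (β : Fin d → Fin d → RN N → ℝ)
    (u : Fin d → H10 Ω) (h k : Fin m) : couplingMatrix a β u h k =
      ∑ i ∈ group a h, ∑ j ∈ group a k, quartic (β i j) (u i) (u j) := rfl

theorem quartic_smul (b : RN N → ℝ) (s t : ℝ) (u v : H10 Ω) :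
    quartic b (s • u) (t • v) = s ^ 2 * t ^ 2 * quartic b u v :=
  integral_quartic_smul b s t u v

section Energy

variable {V : Fin d → RN N → ℝ} {β : Fin d → Fin d → RN N → ℝ}

theorem energy_eq (hN1 : 1 ≤ N) (hN3 : N ≤ 3) (hΩb : Bornology.IsBounded Ω)
    (h0 : BasicAssumptions Ω V β) (u : Fin d → H10 Ω) :
    energy V β u = (1 / 2) * ∑ i, normSq (V i) (u i)
      - (1 / 4) * ∑ i, ∑ j, quartic (β i j) (u i) (u j) := by
  have hq : ∀ i j, Integrable (fun x => β i j x * (u i).fn x ^ 2 * (u j).fn x ^ 2) (vol Ω) :=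
    fun i j => integrable_quartic hN1 hN3 hΩb (h0.β_bdd i j) (u i) (u j)
  rw [energy, integral_finsetSum _ fun i _ => integrable_normSq (h0.V_bdd i) (u i),
    integral_finsetSum _ fun i _ => integrable_finsetSum _ fun j _ => hq i j]
  simp_rw [integral_finsetSum _ fun j _ => hq _ j]
  rfl

theorem quartic_symm (h0 : BasicAssumptions Ω V β) (u : Fin d → H10 Ω) (i j : Fin d) :
    quartic (β i j) (u i) (u j) = quartic (β j i) (u j) (u i) := by
  rcases eq_or_ne i j with rfl | hij
  · rfl
  · refine integral_congr_ae ((h0.β_symm i j hij).mono fun x hx => ?_)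
    simp only [hx]
    ring

theorem hasDerivAt_quartic_path (x b c : ℝ) : HasDerivAt (fun t : ℝ =>
    x + (2 * t + t ^ 2) * (1 / 2 * b) - 1 / 4 * (2 * t + t ^ 2) ^ 2 * c) b 0 := by
  have h1 : HasDerivAt (fun t : ℝ => 2 * t + t ^ 2) 2 0 :=
    (((hasDerivAt_id (0 : ℝ)).const_mul 2).add (hasDerivAt_pow 2 (0 : ℝ))).congr_deriv (by norm_num)
  exact (((h1.mul_const (1 / 2 * b)).const_add x).sub
    (((h1.pow 2).const_mul (1 / 4)).mul_const c)).congr_deriv (by norm_num; ring)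

theorem partialEnergy_self (hN1 : 1 ≤ N) (hN3 : N ≤ 3) (hΩb : Bornology.IsBounded Ω)
    (h0 : BasicAssumptions Ω V β) (u : Fin d → H10 Ω) (i : Fin d) :
    partialEnergy V β i u (u i) =
      normSq (V i) (u i) - ∑ j, quartic (β i j) (u i) (u j) := by
  set n := fun k => normSq (V k) (u k) with hn
  set q := fun k l => quartic (β k l) (u k) (u l) with hq
  -- Moving along the i-th component multiplies u_i by 1 + t, and only (1 + t)² = 1 + (2t + t²)
  -- enters: the energy is a quadratic polynomial in 2t + t².
  have hpath : ∀ t : ℝ, energy V β (u + t • (Pi.single i (u i) : Fin d → H10 Ω)) = energy V β u +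
      (2 * t + t ^ 2) * (1 / 2 * (n i - ∑ j, q i j)) - 1 / 4 * (2 * t + t ^ 2) ^ 2 * q i i := by
    intro t
    set e : Fin d → ℝ := fun k => if k = i then 2 * t + t ^ 2 else 0 with he
    set s : Fin d → ℝ := fun k => if k = i then 1 + t else 1 with hs
    have hs2 : ∀ k, s k ^ 2 = 1 + e k := fun k => by
      by_cases hk : k = i
      · simp only [hs, he, hk, if_true]; ring
      · simp [hs, he, hk]
    have hu : u + t • (Pi.single i (u i) : Fin d → H10 Ω) = fun k => s k • u k := by
      funext k
      by_cases hk : k = i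
      · subst hk
        simp [hs, add_smul]
      · simp [hs, hk]
    have hqs : ∑ k, q k i = ∑ j, q i j :=
      Finset.sum_congr rfl fun k _ => quartic_symm h0 u k i
    rw [hu, energy_eq hN1 hN3 hΩb h0, energy_eq hN1 hN3 hΩb h0]
    simp only [normSq_smul (h0.V_bdd _), quartic_smul, hs2]
    have e1 : ∑ k, (1 + e k) * n k = ∑ k, n k + (2 * t + t ^ 2) * n i := by
      simp [he, add_mul, Finset.sum_add_distrib]
    have e2 : ∑ k, ∑ l, (1 + e k) * (1 + e l) * q k l = ∑ k, ∑ l, q k l +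
        (2 * t + t ^ 2) * ∑ k, q k i + (2 * t + t ^ 2) * ∑ j, q i j +
          (2 * t + t ^ 2) ^ 2 * q i i := by
      have e3 : ∀ k l, (1 + e k) * (1 + e l) * q k l =
          q k l + e l * q k l + e k * q k l + e k * (e l * q k l) := fun k l => by ring
      simp only [e3, Finset.sum_add_distrib, ← Finset.mul_sum]
      simp [he, ← Finset.mul_sum, pow_two, mul_assoc]
    change 1 / 2 * ∑ k, (1 + e k) * n k - 1 / 4 * ∑ k, ∑ l, (1 + e k) * (1 + e l) * q k l =
      1 / 2 * ∑ k, n k - 1 / 4 * ∑ k, ∑ l, q k l + _ - _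
    rw [e1, e2, hqs]
    ring
  -- `lineDeriv` is 0 by default where no derivative exists, so the derivative is exhibited
  -- explicitly.
  have hd : HasLineDerivAt ℝ (energy V β) (n i - ∑ j, q i j) u (Pi.single i (u i)) := by
    rw [HasLineDerivAt]
    simp_rw [hpath]
    exact hasDerivAt_quartic_path _ _ _
  exact hd.lineDeriv

variable {a : Fin (m + 1) → ℕ}

theorem sum_couplingMatrix_row (ha : IsDecomposition m d a) (u : Fin d → H10 Ω) (h : Fin m) :
    ∑ k, couplingMatrix a β u h k = ∑ i ∈ group a h, ∑ j, quartic (β i j) (u i) (u j) := by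
  simp_rw [couplingMatrix_apply]
  rw [Finset.sum_comm]
  exact Finset.sum_congr rfl fun i _ => sum_group ha _

/-- Replaces the derivative conditions by algebraic ones: each X_h equals the h-th row sum of M.
Everything below uses this form. -/
theorem mem_nehari_iff (hN1 : 1 ≤ N) (hN3 : N ≤ 3) (hΩb : Bornology.IsBounded Ω)
    (ha : IsDecomposition m d a) (h0 : BasicAssumptions Ω V β) {u : Fin d → H10 Ω} :
    u ∈ nehari Ω a V β ↔ ∀ h, groupNormSq a V u h ≠ 0 ∧
      groupNormSq a V u h = ∑ k, couplingMatrix a β u h k := by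
  simp only [nehari, Set.mem_ofPred_eq, partialEnergy_self hN1 hN3 hΩb h0, Finset.sum_sub_distrib,
    sub_eq_zero, sum_couplingMatrix_row ha]
  rfl

theorem energy_eq_of_mem_nehari (hN1 : 1 ≤ N) (hN3 : N ≤ 3) (hΩb : Bornology.IsBounded Ω)
    (ha : IsDecomposition m d a) (h0 : BasicAssumptions Ω V β) {u : Fin d → H10 Ω}
    (hu : u ∈ nehari Ω a V β) : energy V β u = (1 / 4) * ∑ h, groupNormSq a V u h := by
  have h1 : ∑ h, groupNormSq a V u h = ∑ i, normSq (V i) (u i) := sum_group ha _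
  have h2 : ∑ h, groupNormSq a V u h = ∑ i, ∑ j, quartic (β i j) (u i) (u j) := by
    rw [← sum_group ha]
    refine Finset.sum_congr rfl fun h _ => ?_
    rw [((mem_nehari_iff hN1 hN3 hΩb ha h0).mp hu h).2, sum_couplingMatrix_row ha]
  rw [energy_eq hN1 hN3 hΩb h0, ← h1, ← h2]
  ring

theorem couplingMatrix_nonpos
    (h2 : ∀ p ∈ K2 d a, ∀ᵐ x ∂(vol Ω), β p.1 p.2 x ≤ 0) (u : Fin d → H10 Ω) {h k : Fin m}
    (hhk : h ≠ k) : couplingMatrix a β u h k ≤ 0 := by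
  rw [couplingMatrix_apply]
  refine Finset.sum_nonpos fun i hi => Finset.sum_nonpos fun j hj => ?_
  refine integral_nonpos_of_ae ((h2 (i, j) ⟨h, k, hhk, hi, hj⟩).mono fun x hx => ?_)
  exact mul_nonpos_of_nonpos_of_nonneg (mul_nonpos_of_nonpos_of_nonneg hx (sq_nonneg _))
    (sq_nonneg _)

theorem groupNormSq_smul (ha : IsDecomposition m d a) (h0 : BasicAssumptions Ω V β)
    (u : Fin d → H10 Ω) (s : Fin m → ℝ) (h : Fin m) :
    groupNormSq a V (fun i => s (groupOf ha i) • u i) h = s h ^ 2 * groupNormSq a V u h := by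
  rw [groupNormSq, groupNormSq, Finset.mul_sum]
  refine Finset.sum_congr rfl fun i hi => ?_
  rw [normSq_smul (h0.V_bdd i), (mem_group_iff ha).mp hi]

theorem couplingMatrix_smul (ha : IsDecomposition m d a)
    (u : Fin d → H10 Ω) (s : Fin m → ℝ) (h k : Fin m) :
    couplingMatrix a β (fun i => s (groupOf ha i) • u i) h k =
      s h ^ 2 * s k ^ 2 * couplingMatrix a β u h k := by
  simp_rw [couplingMatrix_apply, Finset.mul_sum]
  refine Finset.sum_congr rfl fun i hi => Finset.sum_congr rfl fun j hj => ?_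
  rw [quartic_smul, (mem_group_iff ha).mp hi, (mem_group_iff ha).mp hj]

theorem exists_coercive_system (hN1 : 1 ≤ N) (hN3 : N ≤ 3) (hΩo : IsOpen Ω)
    (hΩb : Bornology.IsBounded Ω) (h0 : BasicAssumptions Ω V β) :
    ∃ c : ℝ, 0 < c ∧ ∀ i (v : H10 Ω), c * ‖v‖ ^ 2 ≤ normSq (V i) v := by
  choose c hc hcV using fun i => exists_coercive hN1 hN3 hΩo hΩb (h0.V_bdd i) (h0.V_lower i)
  rcases isEmpty_or_nonempty (Fin d) with hd | hd
  · exact ⟨1, one_pos, fun i => hd.elim i⟩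
  · obtain ⟨k, hk⟩ := Finite.exists_min c
    exact ⟨c k, hc k, fun i v => le_trans (by gcongr; exact hk i) (hcV i v)⟩

theorem groupNormSq_nonneg {c : ℝ} (hc : 0 < c)
    (hcV : ∀ i (v : H10 Ω), c * ‖v‖ ^ 2 ≤ normSq (V i) v) (u : Fin d → H10 Ω) (h : Fin m) :
    0 ≤ groupNormSq a V u h :=
  Finset.sum_nonneg fun i _ => le_trans (by positivity) (hcV i (u i))

/-- The couplings are quartic and bounded through L⁴, the norms quadratic and coercive. This gap in
homogeneity keeps the Nehari set away from zero. -/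
theorem exists_couplingMatrix_diag_le (hN1 : 1 ≤ N) (hN3 : N ≤ 3) (hΩo : IsOpen Ω)
    (hΩb : Bornology.IsBounded Ω) (h0 : BasicAssumptions Ω V β) :
    ∃ K : ℝ, 0 < K ∧ ∀ (u : Fin d → H10 Ω) (h : Fin m),
      couplingMatrix a β u h h ≤ K * groupNormSq a V u h ^ 2 := by
  obtain ⟨c, hc, hcV⟩ := exists_coercive_system hN1 hN3 hΩo hΩb h0
  choose C hC0 hC using fun i j => exists_abs_integral_quartic_le hN1 hN3 hΩb (h0.β_bdd i j)
  set D : ℝ := ∑ i, ∑ j, C i j + 1 with hD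
  have hCD : ∀ i j, C i j ≤ D := fun i j => by
    have h1 : C i j ≤ ∑ j, C i j :=
      Finset.single_le_sum (f := fun j => C i j) (fun j _ => hC0 i j) (Finset.mem_univ j)
    have h2 : ∑ j, C i j ≤ ∑ i, ∑ j, C i j := Finset.single_le_sum
      (f := fun i => ∑ j, C i j) (fun i _ => Finset.sum_nonneg fun j _ => hC0 i j)
      (Finset.mem_univ i)
    linarith
  have hD0 : 0 < D := by
    have : 0 ≤ ∑ i, ∑ j, C i j := Finset.sum_nonneg fun i _ => Finset.sum_nonneg fun j _ => hC0 i j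
    linarith
  refine ⟨D / c ^ 2, by positivity, fun u h => ?_⟩
  have hle : ∀ i, ‖u i‖ ^ 2 ≤ normSq (V i) (u i) / c := fun i => by
    rw [le_div_iff₀ hc, mul_comm]; exact hcV i (u i)
  rw [couplingMatrix_apply, groupNormSq, pow_two (Finset.sum _ _), Finset.sum_mul_sum, Finset.mul_sum]
  refine Finset.sum_le_sum fun i _ => ?_
  rw [Finset.mul_sum]
  refine Finset.sum_le_sum fun j _ => ?_
  calc quartic (β i j) (u i) (u j) ≤ C i j * (‖u i‖ ^ 2 * ‖u j‖ ^ 2) :=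
        (le_abs_self _).trans (hC i j (u i) (u j))
    _ ≤ D * (normSq (V i) (u i) / c * (normSq (V j) (u j) / c)) := by
        gcongr
        · exact hCD i j
        · exact (sq_nonneg _).trans (hle i)
        · exact hle i
        · exact hle j
    _ = _ := by field_simp

/-- A vector whose coupling matrix has positive row sums can be scaled, group by group, so as to
satisfy the Nehari constraints. -/
theorem exists_mem_nehari_of_row_sum_pos (hN1 : 1 ≤ N) (hN3 : N ≤ 3) (hΩo : IsOpen Ω)
    (hΩb : Bornology.IsBounded Ω) (ha : IsDecomposition m d a) (h0 : BasicAssumptions Ω V β)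
    (h2 : ∀ p ∈ K2 d a, ∀ᵐ x ∂(vol Ω), β p.1 p.2 x ≤ 0) (u : Fin d → H10 Ω)
    (hrow : ∀ h, 0 < ∑ k, couplingMatrix a β u h k) :
    ∃ w ∈ nehari Ω a V β, (∀ h, groupNormSq a V u h ≤ ∑ k, couplingMatrix a β u h k) →
      energy V β w ≤ (1 / 4) * ∑ h, groupNormSq a V u h := by
  obtain ⟨c, hc, hcV⟩ := exists_coercive_system hN1 hN3 hΩo hΩb h0
  obtain ⟨K, hK, hKM⟩ := exists_couplingMatrix_diag_le (m := m) (a := a) hN1 hN3 hΩo hΩb h0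
  have hX0 : ∀ h, 0 ≤ groupNormSq a V u h := groupNormSq_nonneg hc hcV u
  -- If X_h vanished, then M_hh ≤ K X_h² = 0, and the nonpositive off-diagonal entries would make
  -- the row sum nonpositive.
  have hX : ∀ h, 0 < groupNormSq a V u h := fun h => (hX0 h).lt_of_ne fun hzero => by
    have h3 := hrow h
    rw [← Finset.add_sum_erase _ _ (Finset.mem_univ h)] at h3
    have h4 : ∑ k ∈ Finset.univ.erase h, couplingMatrix a β u h k ≤ 0 :=
      Finset.sum_nonpos fun k hk => couplingMatrix_nonpos h2 u (Finset.ne_of_mem_erase hk).symm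
    have h5 := hKM u h
    rw [← hzero] at h5
    norm_num at h5
    linarith
  -- Multiplying group h by √s_h turns the constraint into s_h X_h = sum_k s_h s_k M_hk, which is
  -- the linear system M s = X.
  obtain ⟨s, hs0, hs, hs1⟩ := exists_pos_solution
    (fun h k hhk => couplingMatrix_nonpos h2 u hhk) hX hrow
  have hsq : ∀ h, √(s h) ^ 2 = s h := fun h => Real.sq_sqrt (hs0 h).le
  have hmem : (fun i => √(s (groupOf ha i)) • u i) ∈ nehari Ω a V β := by
    rw [mem_nehari_iff hN1 hN3 hΩb ha h0]
    intro h
    have e1 := groupNormSq_smul ha h0 u (fun h => √(s h)) h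
    have e2 := fun k => couplingMatrix_smul (β := β) ha u (fun h => √(s h)) h k
    simp only [hsq] at e1 e2
    rw [e1]
    refine ⟨(mul_pos (hs0 h) (hX h)).ne', ?_⟩
    simp_rw [e2]
    have e3 : ∑ k, couplingMatrix a β u h k * s k = groupNormSq a V u h := congrFun hs h
    rw [← e3, Finset.mul_sum]
    exact Finset.sum_congr rfl fun k _ => by ring
  refine ⟨_, hmem, fun hle => ?_⟩
  rw [energy_eq_of_mem_nehari hN1 hN3 hΩb ha h0 hmem]
  gcongr with h
  rw [groupNormSq_smul ha h0 u (fun h => √(s h)) h, hsq]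
  exact mul_le_of_le_one_left (hX0 h) (hs1 hle h)

end Energy

/-! ### Disjoint bumps and extraction of subsequences. -/

theorem IsTestFun.memLp {φ : RN N → ℝ} (hφ : IsTestFun Ω φ) : MemLp φ 2 (vol Ω) :=
  hφ.1.continuous.memLp_of_hasCompactSupport hφ.2.1

theorem IsTestFun.memLp_gradient {φ : RN N → ℝ} (hφ : IsTestFun Ω φ) :
    MemLp (gradient φ) 2 (vol Ω) :=
  hφ.continuous_gradient.memLp_of_hasCompactSupport
    ((hφ.2.1.fderiv (𝕜 := ℝ)).comp_left (g := (InnerProductSpace.toDual ℝ (RN N)).symm)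
      (map_zero _))

/-- A test function as an element of `H₀¹(Ω)`. -/
def IsTestFun.toH10 {φ : RN N → ℝ} (hφ : IsTestFun Ω φ) : H10 Ω :=
  ⟨WithLp.toLp 2 (hφ.memLp.toLp, hφ.memLp_gradient.toLp), subset_closure
    ⟨φ, hφ, hφ.memLp.coeFn_toLp, hφ.memLp_gradient.coeFn_toLp⟩⟩

theorem IsTestFun.fn_toH10 {φ : RN N → ℝ} (hφ : IsTestFun Ω φ) : hφ.toH10.fn =ᵐ[vol Ω] φ :=
  hφ.memLp.coeFn_toLp

/-- Test functions with disjoint supports in a nonempty open set. -/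
theorem exists_disjoint_testFun (hN1 : 1 ≤ N) (hΩo : IsOpen Ω) (hΩne : Ω.Nonempty) (m : ℕ) :
    ∃ φ : Fin m → RN N → ℝ, (∀ h, IsTestFun Ω (φ h)) ∧ (∀ h, ∃ x, φ h x ≠ 0) ∧
      ∀ h k, h ≠ k → ∀ x, φ h x = 0 ∨ φ k x = 0 := by
  have : Nonempty (Fin N) := ⟨⟨0, hN1⟩⟩
  have hinf : Ω.Infinite := by
    obtain ⟨x, hx⟩ := hΩne
    exact infinite_of_mem_nhds x (hΩo.mem_nhds hx)
  let e : Fin m → RN N := fun h => hinf.natEmbedding Ω h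
  have he : Function.Injective e := fun h k hhk =>
    Fin.ext ((hinf.natEmbedding Ω).injective (Subtype.ext hhk))
  have heΩ : ∀ h, e h ∈ Ω := fun h => (hinf.natEmbedding Ω h).2
  obtain ⟨U, hU, hdisj⟩ := (Set.finite_range e).t2_separation
  have hnhds : ∀ h, U (e h) ∩ Ω ∈ 𝓝 (e h) := fun h =>
    ((hU _).2.inter hΩo).mem_nhds ⟨(hU _).1, heΩ h⟩
  choose φ hφs hφc hφd _ hφ1 using fun h => exists_contDiff_tsupport_subset (n := ⊤) (hnhds h)
  refine ⟨φ, fun h => ⟨hφd h, hφc h, (hφs h).trans Set.inter_subset_right⟩,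
    fun h => ⟨e h, by rw [hφ1]; exact one_ne_zero⟩, fun h k hhk x => ?_⟩
  by_contra! hx
  have h1 : x ∈ U (e h) := (hφs h (subset_tsupport _ hx.1)).1
  have h2 : x ∈ U (e k) := (hφs k (subset_tsupport _ hx.2)).1
  exact Set.disjoint_left.mp (hdisj ⟨h, rfl⟩ ⟨k, rfl⟩ (he.ne hhk)) h1 h2

theorem IsTestFun.integral_pow_four_pos {φ : RN N → ℝ} (hφ : IsTestFun Ω φ) {x : RN N}
    (hx : φ x ≠ 0) : 0 < ∫ x, φ x ^ 4 ∂(vol Ω) := by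
  have h1 : ∫ x, φ x ^ 4 ∂(vol Ω) = ∫ x, φ x ^ 4 := by
    refine setIntegral_eq_integral_of_forall_compl_eq_zero fun y hy => ?_
    rw [Function.notMem_support.mp fun h => hy (hφ.support_subset h)]
    norm_num
  rw [h1]
  refine (hφ.1.continuous.pow 4).integral_pos_of_hasCompactSupport_nonneg_nonzero
    (hφ.2.1.comp_left (g := fun t : ℝ => t ^ 4) (by norm_num)) (fun y => ?_)
    (x := x) (pow_ne_zero 4 hx)
  exact (even_two_mul 2).pow_nonneg (φ y)

theorem exists_subseq_weakTendsto_pi {ι H : Type*} [Fintype ι] [NormedAddCommGroup H]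
    [InnerProductSpace ℝ H] [CompleteSpace H] [TopologicalSpace.SeparableSpace H]
    (u : ℕ → ι → H) (R : ℝ) (hu : ∀ n i, ‖u n i‖ ≤ R) :
    ∃ w : ι → H, ∃ ψ : ℕ → ℕ, StrictMono ψ ∧ ∀ i, WeakTendsto (fun n => u (ψ n) i) (w i) := by
  classical
  have key : ∀ s : Finset ι, ∃ w : ι → H, ∃ ψ : ℕ → ℕ, StrictMono ψ ∧
      ∀ i ∈ s, WeakTendsto (fun n => u (ψ n) i) (w i) := by
    intro s
    induction s using Finset.induction_on with
    | empty => exact ⟨fun _ => 0, id, strictMono_id, by simp⟩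
    | insert j s hj ih =>
      obtain ⟨w, ψ, hψ, hw⟩ := ih
      obtain ⟨z, χ, hχ, hz⟩ := exists_subseq_tendsto_inner (fun n => u (ψ n) j) R
        fun n => hu _ _
      refine ⟨Function.update w j z, ψ ∘ χ, hψ.comp hχ, fun i hi => ?_⟩
      rcases eq_or_ne i j with rfl | hij
      · rw [Function.update_self]
        exact hz
      · rw [Function.update_of_ne hij]
        exact fun v => (hw i (Finset.mem_of_mem_insert_of_ne hi hij) v).comp hχ.tendsto_atTop
  obtain ⟨w, ψ, hψ, hw⟩ := key Finset.univ
  exact ⟨w, ψ, hψ, fun i => hw i (Finset.mem_univ i)⟩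

/-! ### Minimization on the Nehari set. -/

section System

variable {V : Fin d → RN N → ℝ} {β : Fin d → Fin d → RN N → ℝ} {a : Fin (m + 1) → ℕ}

/-- One bump per group, with disjoint supports, makes M diagonal; cooperation inside the groups and
β_ii > 0 make its diagonal positive, and the projection applies. -/
theorem nehari_nonempty (hN1 : 1 ≤ N) (hN3 : N ≤ 3) (hΩo : IsOpen Ω) (hΩne : Ω.Nonempty)
    (hΩb : Bornology.IsBounded Ω) (ha : IsDecomposition m d a) (h0 : BasicAssumptions Ω V β)
    (h1 : ∀ p ∈ K1 d a, ∀ᵐ x ∂(vol Ω), 0 ≤ β p.1 p.2 x)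
    (h2 : ∀ p ∈ K2 d a, ∀ᵐ x ∂(vol Ω), β p.1 p.2 x ≤ 0) : (nehari Ω a V β).Nonempty := by
  obtain ⟨φ, hφ, hφ0, hdisj⟩ := exists_disjoint_testFun hN1 hΩo hΩne m
  set u : Fin d → H10 Ω := fun i => (hφ (groupOf ha i)).toH10 with hu
  have hq : ∀ i j, quartic (β i j) (u i) (u j) =
      ∫ x, β i j x * φ (groupOf ha i) x ^ 2 * φ (groupOf ha j) x ^ 2 ∂(vol Ω) := fun i j => by
    refine integral_congr_ae ?_
    filter_upwards [(hφ (groupOf ha i)).fn_toH10, (hφ (groupOf ha j)).fn_toH10] with x hx hy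
    rw [hx, hy]
  have hoff : ∀ h k, h ≠ k → couplingMatrix a β u h k = 0 := by
    intro h k hhk
    rw [couplingMatrix_apply]
    refine Finset.sum_eq_zero fun i hi => Finset.sum_eq_zero fun j hj => ?_
    rw [hq, (mem_group_iff ha).mp hi, (mem_group_iff ha).mp hj]
    refine integral_eq_zero_of_ae (Eventually.of_forall fun x => ?_)
    rcases hdisj h k hhk x with hx | hx <;> simp [hx]
  have hdiag : ∀ i, 0 < quartic (β i i) (u i) (u i) := by
    intro i
    obtain ⟨μ, hμ, hμβ⟩ := h0.β_diag i
    obtain ⟨x, hx⟩ := hφ0 (groupOf ha i)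
    have hpos := (hφ (groupOf ha i)).integral_pow_four_pos hx
    have hint := integrable_quartic hN1 hN3 hΩb (h0.β_bdd i i) (u i) (u i)
    refine (mul_pos hμ hpos).trans_le ?_
    rw [← integral_const_mul]
    refine integral_mono_of_nonneg (Eventually.of_forall fun y => ?_) hint ?_
    · exact mul_nonneg hμ.le ((even_two_mul 2).pow_nonneg _)
    · filter_upwards [hμβ, (hφ (groupOf ha i)).fn_toH10] with y hy hy'
      rw [hy']
      have : μ * φ (groupOf ha i) y ^ 4 ≤ β i i y * φ (groupOf ha i) y ^ 4 :=
        mul_le_mul_of_nonneg_right hy ((even_two_mul 2).pow_nonneg _)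
      calc _ ≤ _ := this
        _ = _ := by ring
  have hnn : ∀ h : Fin m, ∀ i ∈ group a h, ∀ j ∈ group a h,
      0 ≤ quartic (β i j) (u i) (u j) := by
    intro h i hi j hj
    rcases eq_or_ne i j with rfl | hij
    · exact (hdiag i).le
    · refine integral_nonneg_of_ae ((h1 (i, j) ⟨hij, h, hi, hj⟩).mono fun x hx => ?_)
      exact mul_nonneg (mul_nonneg hx (sq_nonneg _)) (sq_nonneg _)
  have hrow : ∀ h, 0 < ∑ k, couplingMatrix a β u h k := by
    intro h
    rw [Finset.sum_eq_single h (fun k _ hk => hoff h k hk.symm) (by simp), couplingMatrix_apply]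
    obtain ⟨i, hi⟩ := group_nonempty (d := d) ha h
    refine Finset.sum_pos' (fun i hi => Finset.sum_nonneg fun j hj => hnn h i hi j hj)
      ⟨i, hi, Finset.sum_pos' (fun j hj => hnn h i hi j hj) ⟨i, hi, hdiag i⟩⟩
  obtain ⟨w, hw, -⟩ := exists_mem_nehari_of_row_sum_pos hN1 hN3 hΩo hΩb ha h0 h2 u hrow
  exact ⟨w, hw⟩

theorem nehari_subset_domSet (hN1 : 1 ≤ N) (hN3 : N ≤ 3) (hΩo : IsOpen Ω)
    (hΩb : Bornology.IsBounded Ω) (ha : IsDecomposition m d a) (h0 : BasicAssumptions Ω V β)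
    (h2 : ∀ p ∈ K2 d a, ∀ᵐ x ∂(vol Ω), β p.1 p.2 x ≤ 0) :
    nehari Ω a V β ⊆ domSet Ω a β := by
  intro u hu
  obtain ⟨c, hc, hcV⟩ := exists_coercive_system hN1 hN3 hΩo hΩb h0
  refine StrictDiagDominant.of_row_sum_pos (fun h k hhk => couplingMatrix_nonpos h2 u hhk)
    fun h => ?_
  obtain ⟨h3, h4⟩ := (mem_nehari_iff hN1 hN3 hΩb ha h0).mp hu h
  rw [← h4]
  exact (groupNormSq_nonneg hc hcV u h).lt_of_ne h3.symm

/-- On the Nehari set the group norms are bounded away from zero. -/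
theorem exists_pos_le_groupNormSq (hN1 : 1 ≤ N) (hN3 : N ≤ 3) (hΩo : IsOpen Ω)
    (hΩb : Bornology.IsBounded Ω) (ha : IsDecomposition m d a) (h0 : BasicAssumptions Ω V β)
    (h2 : ∀ p ∈ K2 d a, ∀ᵐ x ∂(vol Ω), β p.1 p.2 x ≤ 0) :
    ∃ δ : ℝ, 0 < δ ∧ ∀ u ∈ nehari Ω a V β, ∀ h, δ ≤ groupNormSq a V u h := by
  obtain ⟨c, hc, hcV⟩ := exists_coercive_system hN1 hN3 hΩo hΩb h0
  obtain ⟨K, hK, hKM⟩ := exists_couplingMatrix_diag_le (m := m) (a := a) hN1 hN3 hΩo hΩb h0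
  -- From X_h ≤ M_hh ≤ K X_h² and X_h > 0, division by X_h gives X_h ≥ 1/K.
  refine ⟨K⁻¹, inv_pos.mpr hK, fun u hu h => ?_⟩
  obtain ⟨h3, h4⟩ := (mem_nehari_iff hN1 hN3 hΩb ha h0).mp hu h
  have hpos : 0 < groupNormSq a V u h := (groupNormSq_nonneg hc hcV u h).lt_of_ne h3.symm
  rw [← Finset.add_sum_erase _ _ (Finset.mem_univ h)] at h4
  have h5 : ∑ k ∈ Finset.univ.erase h, couplingMatrix a β u h k ≤ 0 :=
    Finset.sum_nonpos fun k hk => couplingMatrix_nonpos h2 u (Finset.ne_of_mem_erase hk).symm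
  have h6 := hKM u h
  rw [inv_le_iff_one_le_mul₀ hK]
  have h7 : groupNormSq a V u h * 1 ≤ groupNormSq a V u h * (groupNormSq a V u h * K) := by
    nlinarith
  exact le_of_mul_le_mul_left h7 hpos

theorem exists_isMinOn_energy (hN1 : 1 ≤ N) (hN3 : N ≤ 3) (hΩo : IsOpen Ω) (hΩne : Ω.Nonempty)
    (hΩb : Bornology.IsBounded Ω) (ha : IsDecomposition m d a) (h0 : BasicAssumptions Ω V β)
    (h1 : ∀ p ∈ K1 d a, ∀ᵐ x ∂(vol Ω), 0 ≤ β p.1 p.2 x)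
    (h2 : ∀ p ∈ K2 d a, ∀ᵐ x ∂(vol Ω), β p.1 p.2 x ≤ 0) :
    ∃ w ∈ nehari Ω a V β, IsMinOn (energy V β) (nehari Ω a V β) w := by
  obtain ⟨c, hc, hcV⟩ := exists_coercive_system hN1 hN3 hΩo hΩb h0
  obtain ⟨δ, hδ, hδN⟩ := exists_pos_le_groupNormSq hN1 hN3 hΩo hΩb ha h0 h2
  have hX0 : ∀ (u : Fin d → H10 Ω) (h : Fin m), 0 ≤ groupNormSq a V u h :=
    groupNormSq_nonneg hc hcV
  have hne : (energy V β '' nehari Ω a V β).Nonempty :=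
    (nehari_nonempty hN1 hN3 hΩo hΩne hΩb ha h0 h1 h2).image _
  have hbdd : BddBelow (energy V β '' nehari Ω a V β) := by
    refine ⟨0, ?_⟩
    rintro _ ⟨u, hu, rfl⟩
    rw [energy_eq_of_mem_nehari hN1 hN3 hΩb ha h0 hu]
    exact mul_nonneg (by norm_num) (Finset.sum_nonneg fun h _ => hX0 u h)
  obtain ⟨x, -, hxlim, hx⟩ := exists_seq_tendsto_sInf hne hbdd
  choose u hu hux using hx
  have hE : ∀ n, x n = (1 / 4) * ∑ h, groupNormSq a V (u n) h := fun n => by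
    rw [← hux, energy_eq_of_mem_nehari hN1 hN3 hΩb ha h0 (hu n)]
  obtain ⟨M, hM⟩ := hxlim.bddAbove_range
  set R : ℝ := √(4 * M / c) with hR
  have hbound : ∀ n i, ‖u n i‖ ≤ R := fun n i => by
    refine Real.le_sqrt_of_sq_le ?_
    rw [le_div_iff₀ hc, mul_comm]
    have h3 : normSq (V i) (u n i) ≤ ∑ i, normSq (V i) (u n i) :=
      Finset.single_le_sum (f := fun i => normSq (V i) (u n i))
        (fun i _ => le_trans (by positivity) (hcV i (u n i))) (Finset.mem_univ i)
    have h4 : ∑ h, groupNormSq a V (u n) h = ∑ i, normSq (V i) (u n i) := sum_group ha _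
    have h5 : x n ≤ M := hM ⟨n, rfl⟩
    rw [hE, h4] at h5
    linarith [hcV i (u n i)]
  obtain ⟨w, ψ, hψ, hw⟩ := exists_subseq_weakTendsto_pi u R hbound
  -- On the sequence X_h equals a row sum, which is weakly continuous; so X_h converges to the row
  -- sum at w, possibly larger than X_h(w).
  have hrowlim : ∀ h, Tendsto (fun n => groupNormSq a V (u (ψ n)) h) atTop
      (𝓝 (∑ k, couplingMatrix a β w h k)) := by
    intro h
    have e : ∀ n, groupNormSq a V (u (ψ n)) h = ∑ k, couplingMatrix a β (u (ψ n)) h k :=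
      fun n => ((mem_nehari_iff hN1 hN3 hΩb ha h0).mp (hu (ψ n)) h).2
    simp_rw [e, couplingMatrix_apply]
    exact tendsto_finsetSum _ fun k _ => tendsto_finsetSum _ fun i _ => tendsto_finsetSum _
      fun j _ => tendsto_integral_quartic hN1 hN3 hΩb hΩo (h0.β_bdd i j)
        (fun n => hbound (ψ n) i) (hw i) (fun n => hbound (ψ n) j) (hw j)
  have hrow : ∀ h, 0 < ∑ k, couplingMatrix a β w h k := fun h =>
    hδ.trans_le (ge_of_tendsto' (hrowlim h) fun n => hδN _ (hu (ψ n)) h)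
  choose y hy hylim using fun i => (hw i).exists_le_normSq hΩo hΩb (h0.V_bdd i)
    (fun n => hbound (ψ n) i)
  have hle : ∀ h, groupNormSq a V w h ≤ ∑ k, couplingMatrix a β w h k := fun h =>
    le_of_tendsto_of_tendsto' (tendsto_finsetSum _ fun i _ => hylim i) (hrowlim h)
      fun n => Finset.sum_le_sum fun i _ => hy i n
  have hinf : (1 / 4) * ∑ h, ∑ k, couplingMatrix a β w h k =
      sInf (energy V β '' nehari Ω a V β) := by
    refine tendsto_nhds_unique ?_ (hxlim.comp hψ.tendsto_atTop)
    simp only [Function.comp_def, hE]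
    exact (tendsto_finsetSum _ fun h _ => hrowlim h).const_mul _
  -- The weak limit need not satisfy the constraints; its projection z does, with energy at most
  -- (1/4) sum_h X_h(w).
  obtain ⟨z, hz, hzE⟩ := exists_mem_nehari_of_row_sum_pos hN1 hN3 hΩo hΩb ha h0 h2 w hrow
  refine ⟨z, hz, fun v hv => ?_⟩
  calc energy V β z ≤ (1 / 4) * ∑ h, groupNormSq a V w h := hzE hle
    _ ≤ (1 / 4) * ∑ h, ∑ k, couplingMatrix a β w h k := by
        gcongr with h
        exact hle h
    _ = sInf (energy V β '' nehari Ω a V β) := hinf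
    _ ≤ energy V β v := csInf_le hbdd ⟨v, hv, rfl⟩

end System

end NehariSystem

end

theorem proposition1p6 {N d m : ℕ} (hN1 : 1 ≤ N) (hN3 : N ≤ 3) (hd : 2 ≤ d)
    (Ω : Set (NehariSystem.RN N)) (hΩo : IsOpen Ω) (hΩc : IsConnected Ω)
    (hΩb : Bornology.IsBounded Ω)
    (a : Fin (m + 1) → ℕ) (ha : NehariSystem.IsDecomposition m d a)
    (V : Fin d → NehariSystem.RN N → ℝ) (β : Fin d → Fin d → NehariSystem.RN N → ℝ)
    (h0 : NehariSystem.BasicAssumptions Ω V β)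
    (h1 : ∀ p ∈ NehariSystem.K1 d a, ∀ᵐ x ∂(NehariSystem.vol Ω), 0 ≤ β p.1 p.2 x)
    (h2 : ∀ p ∈ NehariSystem.K2 d a, ∀ᵐ x ∂(NehariSystem.vol Ω), β p.1 p.2 x ≤ 0) :
    (∃ u ∈ NehariSystem.nehari Ω a V β,
      IsMinOn (NehariSystem.energy V β) (NehariSystem.nehari Ω a V β) u) ∧
    (∀ u ∈ NehariSystem.nehari Ω a V β,
      IsMinOn (NehariSystem.energy V β) (NehariSystem.nehari Ω a V β) u →
        u ∈ NehariSystem.domSet Ω a β) ∧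
    sInf (NehariSystem.energy V β '' NehariSystem.nehari Ω a V β) =
      sInf (NehariSystem.energy V β ''
        (NehariSystem.nehari Ω a V β ∩ NehariSystem.domSet Ω a β)) := by
  have hsub := NehariSystem.nehari_subset_domSet hN1 hN3 hΩo hΩb ha h0 h2
  refine ⟨NehariSystem.exists_isMinOn_energy hN1 hN3 hΩo hΩc.nonempty hΩb ha h0 h1 h2,
    fun u hu _ => hsub hu, ?_⟩
  rw [Set.inter_eq_left.mpr hsub]
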